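/- Let $G$ be a finite-dimensional real Lie group with identity $e$, acting smoothly from the left on a finite-dimensional smooth manifold $M$; write $\varphi_g(x)=gx$ and $\varphi^x(g)=gx$. For $X\in T_eG$ let $X^r$ be the right invariant vector field on $G$ with $X^r(e)=X$, and let $\tilde X$ be the fundamental vector field on $M$, $\tilde X(x)=T_e(\varphi^x)X$. Let $\Omega(M)=\bigoplus_k\Omega^k(M)$ be the smooth differential forms on $M$ with exterior derivative $d$ and the right $G$-action by the pull-backs $\varphi_g^*$; let $\Omega(G)$ be defined in the same way for the action of $G$ on itself by left translations $L_g$, with exterior derivative $d_G$. For $s\ge 0$ let $C^s(G,\Omega(M))$ be the space of all maps $G^s\to\Omega(M)$, with $$(\delta'c)(g_1,\dots,g_{s+1})=c(g_2,\dots,g_{s+1})+\sum_{i=1}^s(-1)^ic(g_1,\dots,g_ig_{i+1},\dots,g_{s+1})+(-1)^{s+1}\varphi_{g_{s+1}}^*c(g_1,\dots,g_s)$$ and $(\delta''c)(g_1,\dots,g_s)=(-1)^s\,d\,c(g_1,\dots,g_s)$; these are the differentials of the double complex $C^*(G,\Omega(M))=\{C^s(G,\Omega^k(M))\}_{s,k\ge0}$.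 The double complex $C^*(G,\Omega(G))$, with differentials $\delta'_G,\delta''_G$, is defined in the same way. Let $\gamma$ be a smooth singular $q$-cycle on $M$ (real coefficients). Then there is a unique linear map $f_\gamma:\Omega(M)\to\Omega(G)$ which is $0$ on $\Omega^k(M)$ for $k<q$, and which sends $\omega\in\Omega^{p+q}(M)$, $p\ge 0$, to the form $f_\gamma(\omega)\in\Omega^p(G)$ with $$f_\gamma(\omega)(X_1^r,\dots,X_p^r)(g)=\int_\gamma\varphi_g^*\bigl(i(\tilde X_p)\cdots i(\tilde X_1)\omega\bigr)\qquad(X_1,\dots,X_p\in T_eG,\ g\in G).$$ It is $G$-equivariant, $f_\gamma\circ\varphi_g^*=L_g^*\circ f_\gamma$ for all $g\in G$, and satisfies $d_G\circ f_\gamma=f_\gamma\circ d$. The map $F_\gamma:C^*(G,\Omega(M))\to C^*(G,\Omega(G))$, $F_\gamma(c)=f_\gamma\circ c$, is a homomorphism of double complexes lowering the second degree by $q$: it is linear, $\delta'_G\circ F_\gamma=F_\gamma\circ\delta'$, $\delta''_G\circ F_\gamma=F_\gamma\circ\delta''$, it maps $C^s(G,\Omega^{p+q}(M))$ to $C^s(G,\Omega^p(G))$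 for all $s,p\ge 0$, and it vanishes on $C^s(G,\Omega^k(M))$ for $k<q$. -/

import Mathlib

open scoped Manifold ContDiff Topology

noncomputable section

namespace EquivForms

section Calculus

variable {V W X : Type*} [NormedAddCommGroup V] [NormedSpace ℝ V]
  [NormedAddCommGroup W] [NormedSpace ℝ W] [NormedAddCommGroup X] [NormedSpace ℝ X]

/-- Antisymmetrization, normalized to be a left inverse of the inclusion of alternating maps
into multilinear maps. -/
def altProj (V : Type*) [NormedAddCommGroup V] [NormedSpace ℝ V] (k : ℕ) :
    ContinuousMultilinearMap ℝ (fun _ : Fin k => V) ℝ →L[ℝ] V [⋀^Fin k]→L[ℝ] ℝ :=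
  LinearMap.mkContinuous
    { toFun := fun f => ((k.factorial : ℝ)⁻¹) • ContinuousMultilinearMap.alternatization f
      map_add' := fun f g => by rw [map_add, smul_add]
      map_smul' := fun c f => by
        ext v
        simp [ContinuousMultilinearMap.alternatization_apply_apply, Finset.mul_sum]
        refine Finset.sum_congr rfl fun σ _ => ?_
        simp only [Units.smul_def, zsmul_eq_mul]
        ring }
    1 fun f => by
      refine ContinuousAlternatingMap.opNorm_le_bound _ (by positivity) fun v => ?_
      have h : ‖ContinuousMultilinearMap.alternatization f v‖
          ≤ (k.factorial : ℝ) * (‖f‖ * ∏ i, ‖v i‖) := by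
        rw [ContinuousMultilinearMap.alternatization_apply_apply]
        refine (norm_sum_le _ _).trans ?_
        have : ∀ σ ∈ (Finset.univ : Finset (Equiv.Perm (Fin k))),
            ‖Equiv.Perm.sign σ • f (v ∘ σ)‖ ≤ ‖f‖ * ∏ i, ‖v i‖ := by
          intro σ _
          have h1 : ‖Equiv.Perm.sign σ • f (v ∘ σ)‖ = ‖f (v ∘ σ)‖ := by
            rcases Int.units_eq_one_or (Equiv.Perm.sign σ) with h | h <;> simp [h]
          rw [h1]
          refine (f.le_opNorm _).trans (le_of_eq ?_)
          congr 1
          exact Equiv.prod_comp σ (fun i => ‖v i‖)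
        refine (Finset.sum_le_card_nsmul _ _ _ this).trans (le_of_eq ?_)
        simp [Fintype.card_perm]
      have hk : (0 : ℝ) < k.factorial := by positivity
      calc ‖((k.factorial : ℝ)⁻¹ • ContinuousMultilinearMap.alternatization f) v‖
          = (k.factorial : ℝ)⁻¹ * ‖ContinuousMultilinearMap.alternatization f v‖ := by
            rw [ContinuousAlternatingMap.smul_apply, norm_smul]; simp
        _ ≤ (k.factorial : ℝ)⁻¹ * ((k.factorial : ℝ) * (‖f‖ * ∏ i, ‖v i‖)) := by gcongr
        _ = 1 * ‖f‖ * ∏ i, ‖v i‖ := by field_simp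

lemma altProj_coe {k : ℕ} (f : V [⋀^Fin k]→L[ℝ] ℝ) :
    altProj V k f.toContinuousMultilinearMap = f := by
  ext v
  have hk : (k.factorial : ℝ) ≠ 0 := by positivity
  have h : ∀ σ : Equiv.Perm (Fin k), Equiv.Perm.sign σ • f (v ∘ σ) = f v := by
    intro σ
    have h1 : f (v ∘ σ) = Equiv.Perm.sign σ • f v := f.toAlternatingMap.map_perm v σ
    rw [h1, smul_smul]; simp
  change (k.factorial : ℝ)⁻¹ •
    ContinuousMultilinearMap.alternatization f.toContinuousMultilinearMap v = f v
  rw [ContinuousMultilinearMap.alternatization_apply_apply]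
  have : ∀ σ ∈ (Finset.univ : Finset (Equiv.Perm (Fin k))),
      Equiv.Perm.sign σ • f.toContinuousMultilinearMap (v ∘ σ) = f v := fun σ _ => h σ
  rw [Finset.sum_congr rfl this]
  simp [Fintype.card_perm, hk]

/-- The pullback of an alternating map along a linear map depends smoothly on both. -/
lemma contDiffAt_compContinuousLinearMap {n : WithTop ℕ∞} {k : ℕ}
    {A : X → W [⋀^Fin k]→L[ℝ] ℝ} {B : X → V →L[ℝ] W} {x : X}
    (hA : ContDiffAt ℝ n A x) (hB : ContDiffAt ℝ n B x) :
    ContDiffAt ℝ n (fun y => (A y).compContinuousLinearMap (B y)) x := by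
  have e : (fun y => (A y).compContinuousLinearMap (B y)) = fun y =>
      altProj V k
        (ContinuousMultilinearMap.compContinuousLinearMapContinuousMultilinear ℝ
          (fun _ : Fin k => V) (fun _ => W) ℝ (fun _ => B y)
          (ContinuousAlternatingMap.toContinuousMultilinearMapCLM ℝ (A y))) := by
    funext y
    rw [← altProj_coe ((A y).compContinuousLinearMap (B y))]
    rfl
  rw [e]
  refine (altProj V k).contDiff.contDiffAt.comp x ?_
  refine ContDiffAt.clm_apply ?_ ?_
  · refine (ContinuousMultilinearMap.contDiff _).contDiffAt.comp x ?_
    exact contDiffAt_pi.2 fun _ => hB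
  · exact ContDiffAt.comp x (ContinuousLinearMap.contDiff _).contDiffAt hA

lemma contDiffAt_extDeriv {k : ℕ} {A : V → V [⋀^Fin k]→L[ℝ] ℝ} {x : V}
    (hA : ContDiffAt ℝ ∞ A x) : ContDiffAt ℝ ∞ (extDeriv A) x := by
  have h : ContDiffAt ℝ ∞ (fderiv ℝ A) x := hA.fderiv_right (by simp)
  exact (ContinuousAlternatingMap.alternatizeUncurryFinCLM ℝ V ℝ (n := k)).contDiff.contDiffAt.comp
    x h

end Calculus

/-! ### Differential forms on manifolds -/

section Forms

variable (E M : Type*) [NormedAddCommGroup E] [NormedSpace ℝ E] [TopologicalSpace M]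
  [ChartedSpace E M]

/-- A not necessarily smooth differential form of degree `k`: an alternating `k`-linear form on
each tangent space. -/
abbrev RawForm (k : ℕ) : Type _ := ∀ x : M, TangentSpace 𝓘(ℝ, E) x [⋀^Fin k]→L[ℝ] ℝ

variable {E M}
variable {F N : Type*} [NormedAddCommGroup F] [NormedSpace ℝ F] [TopologicalSpace N]
  [ChartedSpace F N]
variable {D P : Type*} [NormedAddCommGroup D] [NormedSpace ℝ D] [TopologicalSpace P]
  [ChartedSpace D P]

/-- The pullback `f^* η`. -/
def pullback {k : ℕ} (f : M → N) (η : RawForm F N k) : RawForm E M k :=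
  fun x => (η (f x)).compContinuousLinearMap (mfderiv 𝓘(ℝ, E) 𝓘(ℝ, F) f x)

/-- The expression of a form in the preferred chart at `x`: its pullback under the inverse of the
chart. It is meaningful on the target of the chart. -/
def chartRep {k : ℕ} (θ : RawForm E M k) (x : M) : E → E [⋀^Fin k]→L[ℝ] ℝ :=
  pullback (E := E) (M := E) (extChartAt 𝓘(ℝ, E) x).symm θ

/-- A form is smooth if all its expressions in charts are smooth. -/
def IsSmoothForm {k : ℕ} (θ : RawForm E M k) : Prop :=
  ∀ x : M, ContDiffOn ℝ ∞ (chartRep θ x) (extChartAt 𝓘(ℝ, E) x).target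

/-- The exterior derivative, computed at each point in the preferred chart at this point. -/
def extDerivRaw {k : ℕ} (θ : RawForm E M k) : RawForm E M (k + 1) := fun x =>
  (extDeriv (chartRep θ x) (extChartAt 𝓘(ℝ, E) x x)).compContinuousLinearMap
    (mfderiv 𝓘(ℝ, E) 𝓘(ℝ, E) (extChartAt 𝓘(ℝ, E) x) x)

lemma pullback_pullback_apply {k : ℕ} {f : M → N} {g : P → M} (η : RawForm F N k) {x : P}
    (hf : MDifferentiableAt 𝓘(ℝ, E) 𝓘(ℝ, F) f (g x))
    (hg : MDifferentiableAt 𝓘(ℝ, D) 𝓘(ℝ, E) g x) :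
    pullback (E := D) g (pullback (E := E) f η) x = pullback (E := D) (f ∘ g) η x := by
  simp only [pullback]
  rw [mfderiv_comp x hf hg]
  rfl

lemma pullback_congr {k : ℕ} {f g : M → N} (η : RawForm F N k) {x : M} (h : f =ᶠ[𝓝 x] g) :
    pullback (E := E) f η x = pullback (E := E) g η x := by
  simp only [pullback]
  rw [h.mfderiv_eq, h.self_of_nhds]

lemma pullback_id {k : ℕ} (θ : RawForm E M k) : pullback (E := E) (id : M → M) θ = θ := by
  funext x
  simp only [pullback]
  rw [mfderiv_id]
  ext v
  rfl

lemma chart_change [IsManifold 𝓘(ℝ, E) ∞ M] [IsManifold 𝓘(ℝ, F) ∞ N] {k : ℕ} {f : M → N}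
    (hf : ContMDiff 𝓘(ℝ, E) 𝓘(ℝ, F) ∞ f) (η : RawForm F N k) (x : M) (z : N) {y₀ : E}
    (hy₀ : y₀ ∈ (extChartAt 𝓘(ℝ, E) x).target)
    (hz : f ((extChartAt 𝓘(ℝ, E) x).symm y₀) ∈ (extChartAt 𝓘(ℝ, F) z).source) :
    let u := extChartAt 𝓘(ℝ, F) z ∘ f ∘ (extChartAt 𝓘(ℝ, E) x).symm
    ContDiffAt ℝ ∞ u y₀ ∧ chartRep (pullback (E := E) f η) x =ᶠ[𝓝 y₀]
      fun y => (chartRep η z (u y)).compContinuousLinearMap (fderiv ℝ u y) := by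
  intro u
  have hopen : IsOpen (extChartAt 𝓘(ℝ, E) x).target := isOpen_extChartAt_target x
  have hsm : ∀ y ∈ (extChartAt 𝓘(ℝ, E) x).target,
      ContMDiffAt 𝓘(ℝ, E) 𝓘(ℝ, E) ∞ (extChartAt 𝓘(ℝ, E) x).symm y := fun y hy =>
    (contMDiffOn_extChartAt_symm x).contMDiffAt (hopen.mem_nhds hy)
  have hfs : ∀ y ∈ (extChartAt 𝓘(ℝ, E) x).target,
      ContMDiffAt 𝓘(ℝ, E) 𝓘(ℝ, F) ∞ (f ∘ (extChartAt 𝓘(ℝ, E) x).symm) y := fun y hy =>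
    hf.contMDiffAt.comp y (hsm y hy)
  have hev : ∀ᶠ y in 𝓝 y₀, y ∈ (extChartAt 𝓘(ℝ, E) x).target ∧
      (f ∘ (extChartAt 𝓘(ℝ, E) x).symm) y ∈ (extChartAt 𝓘(ℝ, F) z).source :=
    Filter.Eventually.and (hopen.mem_nhds hy₀) ((hfs y₀ hy₀).continuousAt.preimage_mem_nhds
      ((isOpen_extChartAt_source z).mem_nhds hz))
  have hu : ∀ y, (y ∈ (extChartAt 𝓘(ℝ, E) x).target ∧
      (f ∘ (extChartAt 𝓘(ℝ, E) x).symm) y ∈ (extChartAt 𝓘(ℝ, F) z).source) →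
      ContMDiffAt 𝓘(ℝ, E) 𝓘(ℝ, F) ∞ u y := fun y hy =>
    (contMDiffAt_extChartAt' (by simpa using hy.2)).comp y (hfs y hy.1)
  refine ⟨(hu y₀ hev.self_of_nhds).contDiffAt, ?_⟩
  filter_upwards [hev, hev.eventually_nhds] with y hy hy'
  have h1 : chartRep (pullback (E := E) f η) x y =
      pullback (E := E) (M := E) (f ∘ (extChartAt 𝓘(ℝ, E) x).symm) η y :=
    pullback_pullback_apply η (hf.mdifferentiableAt (by simp))
      ((hsm y hy.1).mdifferentiableAt (by simp))
  have h2 : f ∘ (extChartAt 𝓘(ℝ, E) x).symm =ᶠ[𝓝 y] (extChartAt 𝓘(ℝ, F) z).symm ∘ u := by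
    filter_upwards [hy'] with w hw
    exact ((extChartAt 𝓘(ℝ, F) z).left_inv hw.2).symm
  have hut : u y ∈ (extChartAt 𝓘(ℝ, F) z).target := (extChartAt 𝓘(ℝ, F) z).map_source hy.2
  have h3 : MDifferentiableAt 𝓘(ℝ, F) 𝓘(ℝ, F) (extChartAt 𝓘(ℝ, F) z).symm (u y) :=
    ((contMDiffOn_extChartAt_symm (n := ∞) z).contMDiffAt
      ((isOpen_extChartAt_target z).mem_nhds hut)).mdifferentiableAt (by simp)
  rw [h1, pullback_congr η h2,
    ← pullback_pullback_apply (E := F) (M := F) η h3 ((hu y hy).mdifferentiableAt (by simp))]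
  simp only [pullback, chartRep, mfderiv_eq_fderiv]
  rfl

/-- Pullbacks of smooth forms under smooth maps are smooth. -/
lemma IsSmoothForm.pullback [IsManifold 𝓘(ℝ, E) ∞ M] [IsManifold 𝓘(ℝ, F) ∞ N] {k : ℕ}
    {f : M → N} (hf : ContMDiff 𝓘(ℝ, E) 𝓘(ℝ, F) ∞ f) {η : RawForm F N k} (hη : IsSmoothForm η) :
    IsSmoothForm (pullback (E := E) f η) := by
  intro x y₀ hy₀
  set z := f ((extChartAt 𝓘(ℝ, E) x).symm y₀) with hz
  obtain ⟨hu, he⟩ := chart_change hf η x z hy₀ (by simp [hz])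
  refine ContDiffAt.contDiffWithinAt (ContDiffAt.congr_of_eventuallyEq ?_ he)
  refine contDiffAt_compContinuousLinearMap ?_ (hu.fderiv_right (by simp))
  refine ContDiffAt.comp y₀ ((hη z).contDiffAt ?_) hu
  refine (isOpen_extChartAt_target z).mem_nhds ?_
  exact (extChartAt 𝓘(ℝ, F) z).map_source (by simp [hz])

/-- The exterior derivative is given by the usual formula in every preferred chart. -/
lemma chartRep_extDerivRaw [IsManifold 𝓘(ℝ, E) ∞ M] {k : ℕ} {θ : RawForm E M k}
    (hθ : IsSmoothForm θ) (x : M) {y₀ : E} (hy₀ : y₀ ∈ (extChartAt 𝓘(ℝ, E) x).target) :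
    chartRep (extDerivRaw θ) x y₀ = extDeriv (chartRep θ x) y₀ := by
  set z := (extChartAt 𝓘(ℝ, E) x).symm y₀ with hz
  obtain ⟨hu, he⟩ := chart_change (f := (id : M → M)) contMDiff_id θ x z hy₀ (by simp [hz])
  set u := extChartAt 𝓘(ℝ, E) z ∘ id ∘ (extChartAt 𝓘(ℝ, E) x).symm with hu_def
  have huz : u y₀ = extChartAt 𝓘(ℝ, E) z z := rfl
  rw [pullback_id] at he
  have hd : DifferentiableAt ℝ (chartRep θ z) (u y₀) :=
    ((hθ z).contDiffAt ((isOpen_extChartAt_target z).mem_nhds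
      (mem_extChartAt_target z))).differentiableAt (by simp)
  rw [he.extDeriv_eq, extDeriv_pullback hd hu (by
    simpa using (WithTop.coe_le_coe.2 (le_top : (2 : ℕ∞) ≤ ⊤)))]
  have hs : MDifferentiableAt 𝓘(ℝ, E) 𝓘(ℝ, E) (extChartAt 𝓘(ℝ, E) x).symm y₀ :=
    ((contMDiffOn_extChartAt_symm (n := ∞) x).contMDiffAt
      ((isOpen_extChartAt_target x).mem_nhds hy₀)).mdifferentiableAt (by simp)
  have hc : MDifferentiableAt 𝓘(ℝ, E) 𝓘(ℝ, E) (extChartAt 𝓘(ℝ, E) z)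
      ((extChartAt 𝓘(ℝ, E) x).symm y₀) :=
    (contMDiffAt_extChartAt (n := ∞) (x := z)).mdifferentiableAt (by simp)
  have : fderiv ℝ u y₀ = (mfderiv 𝓘(ℝ, E) 𝓘(ℝ, E) (extChartAt 𝓘(ℝ, E) z) z).comp
      (mfderiv 𝓘(ℝ, E) 𝓘(ℝ, E) (extChartAt 𝓘(ℝ, E) x).symm y₀) := by
    rw [← mfderiv_eq_fderiv]
    exact mfderiv_comp y₀ hc hs
  rw [this]
  rfl

/-- The exterior derivative of a smooth form is smooth. -/
lemma IsSmoothForm.extDerivRaw [IsManifold 𝓘(ℝ, E) ∞ M] {k : ℕ} {θ : RawForm E M k}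
    (hθ : IsSmoothForm θ) : IsSmoothForm (extDerivRaw θ) := by
  intro x y₀ hy₀
  have hn := (isOpen_extChartAt_target (I := 𝓘(ℝ, E)) x).mem_nhds hy₀
  refine ContDiffAt.contDiffWithinAt (ContDiffAt.congr_of_eventuallyEq
    (contDiffAt_extDeriv ((hθ x).contDiffAt hn)) ?_)
  filter_upwards [hn] with y hy
  exact chartRep_extDerivRaw hθ x hy

lemma chartRep_add {k : ℕ} (θ η : RawForm E M k) (x : M) :
    chartRep (θ + η) x = chartRep θ x + chartRep η x := rfl

lemma chartRep_smul {k : ℕ} (a : ℝ) (θ : RawForm E M k) (x : M) :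
    chartRep (a • θ) x = a • chartRep θ x := rfl

variable (E M)

/-- The space `Ω^k(M)` of smooth differential forms of degree `k`. -/
def Form (k : ℕ) : Submodule ℝ (RawForm E M k) where
  carrier := {θ | IsSmoothForm θ}
  add_mem' := fun h₁ h₂ x => (h₁ x).add (h₂ x)
  zero_mem' := fun _ => contDiffOn_const (c := 0)
  smul_mem' := fun a _ h x => contDiffOn_const (c := a) |>.smul (h x)

/-- The graded space `Ω(M)` of all smooth differential forms, an element being given by its
homogeneous components. Forms of degree larger than `dim M` vanish, so on a finite-dimensional
manifold the product over the degrees is the direct sum. -/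
abbrev DeRham : Type _ := ∀ k : ℕ, Form E M k

variable {E M}

/-- The exterior derivative `Ω^k(M) → Ω^{k+1}(M)`. -/
def extD [IsManifold 𝓘(ℝ, E) ∞ M] (k : ℕ) : Form E M k →ₗ[ℝ] Form E M (k + 1) where
  toFun θ := ⟨extDerivRaw θ.1, IsSmoothForm.extDerivRaw θ.2⟩
  map_add' θ η := by
    ext1
    funext x
    have h : ∀ ζ : Form E M k,
        DifferentiableAt ℝ (chartRep ζ.1 x) (extChartAt 𝓘(ℝ, E) x x) := fun ζ =>
      ((ζ.2 x).contDiffAt ((isOpen_extChartAt_target x).mem_nhds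
        (mem_extChartAt_target x))).differentiableAt (by simp)
    change extDerivRaw (θ.1 + η.1) x = extDerivRaw θ.1 x + extDerivRaw η.1 x
    simp only [extDerivRaw, chartRep_add]
    rw [extDeriv_add (h θ) (h η)]
    rfl
  map_smul' a θ := by
    ext1
    funext x
    change extDerivRaw (a • θ.1) x = a • extDerivRaw θ.1 x
    simp only [extDerivRaw, chartRep_smul]
    rw [extDeriv_smul]
    rfl

/-- The exterior derivative `d` on `Ω(M)`. -/
def dR [IsManifold 𝓘(ℝ, E) ∞ M] : DeRham E M →ₗ[ℝ] DeRham E M where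
  toFun θ := fun k => match k with
    | 0 => 0
    | k + 1 => extD k (θ k)
  map_add' θ η := by
    funext k
    cases k with
    | zero => simp
    | succ k => exact map_add (extD k) (θ k) (η k)
  map_smul' a θ := by
    funext k
    cases k with
    | zero => simp
    | succ k => exact map_smul (extD k) a (θ k)

end Forms

/-! ### The action of a Lie group on forms, and group cochains -/

section Action

variable {B G : Type*} [NormedAddCommGroup B] [NormedSpace ℝ B] [TopologicalSpace G]
  [ChartedSpace B G] [Group G]
variable {E M : Type*} [NormedAddCommGroup E] [NormedSpace ℝ E] [TopologicalSpace M]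
  [ChartedSpace E M] [MulAction G M]

variable (B) in
lemma contMDiff_action [ContMDiffSMul 𝓘(ℝ, B) 𝓘(ℝ, E) ∞ G M] (g : G) :
    ContMDiff 𝓘(ℝ, E) 𝓘(ℝ, E) ∞ (fun x : M => g • x) :=
  (contMDiff_smul (I := 𝓘(ℝ, B)) (I' := 𝓘(ℝ, E)) (n := ∞) (G := G) (M := M)).comp
    (contMDiff_const.prodMk contMDiff_id)

variable (B) in
/-- The right action of `g ∈ G` on `Ω(M)`: the pullback along `x ↦ g • x`. -/
def act [IsManifold 𝓘(ℝ, E) ∞ M] [ContMDiffSMul 𝓘(ℝ, B) 𝓘(ℝ, E) ∞ G M] (g : G) :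
    DeRham E M →ₗ[ℝ] DeRham E M where
  toFun θ := fun k => ⟨pullback (E := E) (fun x : M => g • x) (θ k).1,
    IsSmoothForm.pullback (contMDiff_action B g) (θ k).2⟩
  map_add' _ _ := rfl
  map_smul' _ _ := rfl

/-- `C^s(G, A)`: all maps from `G^s` to `A`. -/
abbrev Cochain (G A : Type*) (s : ℕ) : Type _ := (Fin s → G) → A

variable (B) in
/-- The first differential, that of the nonhomogeneous cochains of the abstract group `G`
with values in the right module `Ω(M)`. -/
def delta' [IsManifold 𝓘(ℝ, E) ∞ M] [ContMDiffSMul 𝓘(ℝ, B) 𝓘(ℝ, E) ∞ G M] {s : ℕ}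
    (c : Cochain G (DeRham E M) s) : Cochain G (DeRham E M) (s + 1) := fun g =>
  c (Fin.tail g)
    + ∑ i : Fin s, (-1 : ℝ) ^ ((i : ℕ) + 1) • c (Fin.contractNth i.castSucc (· * ·) g)
    + (-1 : ℝ) ^ (s + 1) • act B (g (Fin.last s)) (c (Fin.init g))

/-- The second differential `(δ''c)(g₁, …, g_s) = (-1)^s d(c(g₁, …, g_s))`. -/
def delta'' [IsManifold 𝓘(ℝ, E) ∞ M] {s : ℕ} (c : Cochain G (DeRham E M) s) :
    Cochain G (DeRham E M) s := fun g => (-1 : ℝ) ^ s • dR (c g)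

variable (G E M) in
/-- The subspace `C^s(G, Ω^k(M))` of `C^s(G, Ω(M))`. -/
def bidegree (s k : ℕ) : Submodule ℝ (Cochain G (DeRham E M) s) where
  carrier := {c | ∀ g j, j ≠ k → c g j = 0}
  add_mem' := fun h₁ h₂ g j hj => by
    rw [Pi.add_apply, Pi.add_apply, h₁ g j hj, h₂ g j hj, add_zero]
  zero_mem' := fun _ _ _ => rfl
  smul_mem' := fun a c h g j hj => by
    change a • c g j = 0
    rw [h g j hj, smul_zero]

variable {F N : Type*} [NormedAddCommGroup F] [NormedSpace ℝ F] [TopologicalSpace N]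
  [ChartedSpace F N] [MulAction G N]

variable (B) in
/-- A family of linear maps `C^s(G, Ω(M)) → C^s(G, Ω(N))` is a homomorphism of double complexes
lowering the second degree by `q` if it commutes with both differentials, sends
`C^s(G, Ω^{q+p}(M))` to `C^s(G, Ω^p(N))`, and vanishes on `C^s(G, Ω^k(M))` for `k < q`. -/
structure IsDoubleComplexHom [IsManifold 𝓘(ℝ, E) ∞ M] [IsManifold 𝓘(ℝ, F) ∞ N]
    [ContMDiffSMul 𝓘(ℝ, B) 𝓘(ℝ, E) ∞ G M] [ContMDiffSMul 𝓘(ℝ, B) 𝓘(ℝ, F) ∞ G N] (q : ℕ)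
    (Φ : ∀ s, Cochain G (DeRham E M) s →ₗ[ℝ] Cochain G (DeRham F N) s) : Prop where
  comm_delta' : ∀ s (c : Cochain G (DeRham E M) s), delta' B (Φ s c) = Φ (s + 1) (delta' B c)
  comm_delta'' : ∀ s (c : Cochain G (DeRham E M) s), delta'' (Φ s c) = Φ s (delta'' c)
  lowers : ∀ s p, ∀ c ∈ bidegree G E M s (q + p), Φ s c ∈ bidegree G F N s p
  vanishes : ∀ s k, k < q → ∀ c ∈ bidegree G E M s k, Φ s c = 0

end Action

/-! ### Smooth singular chains and integration -/

section Chains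

variable (E M : Type*) [NormedAddCommGroup E] [NormedSpace ℝ E] [TopologicalSpace M]
  [ChartedSpace E M]

/-- A smooth singular simplex: a map from the standard simplex which extends to a smooth map on a
neighbourhood of the simplex. -/
@[ext]
structure SmoothSimplex (q : ℕ) where
  toFun : stdSimplex ℝ (Fin (q + 1)) → M
  smooth' : ∃ (U : Set (Fin (q + 1) → ℝ)) (f : (Fin (q + 1) → ℝ) → M), IsOpen U ∧
    stdSimplex ℝ (Fin (q + 1)) ⊆ U ∧ ContMDiffOn 𝓘(ℝ, Fin (q + 1) → ℝ) 𝓘(ℝ, E) ∞ f U ∧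
    ∀ t : stdSimplex ℝ (Fin (q + 1)), toFun t = f t.1

/-- Smooth singular chains with real coefficients. -/
abbrev SmoothChain (q : ℕ) : Type _ := SmoothSimplex E M q →₀ ℝ

variable {E M}

/-- The `i`-th face of a smooth singular simplex. -/
def SmoothSimplex.face {q : ℕ} (σ : SmoothSimplex E M (q + 1)) (i : Fin (q + 2)) :
    SmoothSimplex E M q where
  toFun t := σ.toFun (stdSimplex.map i.succAbove t)
  smooth' := by
    obtain ⟨U, f, hU, hsub, hf, he⟩ := σ.smooth'
    let L : (Fin (q + 1) → ℝ) →L[ℝ] (Fin (q + 2) → ℝ) :=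
      LinearMap.toContinuousLinearMap (FunOnFinite.linearMap ℝ ℝ i.succAbove)
    refine ⟨L ⁻¹' U, f ∘ L, hU.preimage L.continuous, ?_, ?_, fun t => he _⟩
    · intro t ht
      exact hsub (stdSimplex.map i.succAbove ⟨t, ht⟩).2
    · exact hf.comp L.contDiff.contMDiff.contMDiffOn fun _ h => h

/-- The boundary `∂σ = ∑ i, (-1)^i σ_i` of smooth singular chains. -/
def boundary (q : ℕ) : SmoothChain E M (q + 1) →ₗ[ℝ] SmoothChain E M q :=
  Finsupp.linearCombination ℝ fun σ : SmoothSimplex E M (q + 1) =>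
    ∑ i : Fin (q + 2), (-1 : ℝ) ^ (i : ℕ) • Finsupp.single (σ.face i) (1 : ℝ)

/-- Smooth singular cycles; every chain of dimension `0` is a cycle. -/
def IsCycle : {q : ℕ} → SmoothChain E M q → Prop
  | 0, _ => True
  | q + 1, γ => boundary q γ = 0

/-- The simplex `{t ∈ ℝ^q | t_i ≥ 0, ∑ t_i ≤ 1}`. -/
def cornerSimplex (q : ℕ) : Set (Fin q → ℝ) := {t | (∀ i, 0 ≤ t i) ∧ ∑ i, t i ≤ 1}

/-- The barycentric coordinates `(1 - ∑ t_i, t_1, …, t_q)`. -/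
def bary {q : ℕ} (t : Fin q → ℝ) : Fin (q + 1) → ℝ := Fin.cons (1 - ∑ i, t i) t

lemma bary_mem {q : ℕ} {t : Fin q → ℝ} (ht : t ∈ cornerSimplex q) :
    bary t ∈ stdSimplex ℝ (Fin (q + 1)) := by
  refine ⟨fun i => ?_, ?_⟩
  · refine Fin.cases ?_ (fun j => ?_) i
    · simpa [bary] using ht.2
    · simpa [bary] using ht.1 j
  · simp [bary, Fin.sum_univ_succ]

open Classical in
/-- A smooth singular simplex in the coordinates `t` on the simplex `cornerSimplex q` (extended by
a constant outside of it, where it is never used). -/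
def SmoothSimplex.param {q : ℕ} (σ : SmoothSimplex E M q) (t : Fin q → ℝ) : M :=
  if ht : t ∈ cornerSimplex q then σ.toFun ⟨bary t, bary_mem ht⟩
  else σ.toFun (stdSimplex.vertex 0)

/-- The integral `∫_σ η = ∫_{Δ} σ^*η` of a form of degree `q` over a smooth singular simplex. -/
def SmoothSimplex.integral {q : ℕ} (σ : SmoothSimplex E M q) (η : RawForm E M q) : ℝ :=
  ∫ t in cornerSimplex q, η (σ.param t) fun i =>
    mfderivWithin 𝓘(ℝ, Fin q → ℝ) 𝓘(ℝ, E) σ.param (cornerSimplex q) t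
      (Pi.single i (1 : ℝ) : Fin q → ℝ)

/-- The integral of a form of degree `q` over a smooth singular chain. -/
def chainIntegral {q : ℕ} (γ : SmoothChain E M q) (η : RawForm E M q) : ℝ :=
  γ.sum fun σ a => a * σ.integral η

end Chains

/-! ### The map `f_γ` -/

/-- The iterated interior product `i(X_p) ⋯ i(X_1) θ`, where `i(X)θ = θ(X, ⋯)`. -/
def contract {V : Type*} [NormedAddCommGroup V] [NormedSpace ℝ V] {q : ℕ} :
    (p : ℕ) → (Fin p → V) → (V [⋀^Fin (q + p)]→L[ℝ] ℝ) → V [⋀^Fin q]→L[ℝ] ℝ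
  | 0, _, θ => θ
  | p + 1, X, θ => contract p (Fin.tail X) (ContinuousAlternatingMap.curryLeft θ (X 0))

section FGamma

variable {B G : Type*} [NormedAddCommGroup B] [NormedSpace ℝ B] [TopologicalSpace G]
  [ChartedSpace B G] [Group G]
variable {E M : Type*} [NormedAddCommGroup E] [NormedSpace ℝ E] [TopologicalSpace M]
  [ChartedSpace E M] [MulAction G M]

/-- The right invariant vector field `X^r` on `G` with `X^r(e) = X`. -/
def rightInvariantField (X : TangentSpace 𝓘(ℝ, B) (1 : G)) (g : G) : TangentSpace 𝓘(ℝ, B) g :=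
  (mfderiv 𝓘(ℝ, B) 𝓘(ℝ, B) (fun h : G => h * g) 1 X : B)

variable (E M) in
/-- The fundamental vector field of `X` on `M`: its value at `x` is the image of `X` under the
derivative at `e` of `g ↦ g • x`. -/
def fundamentalField (X : TangentSpace 𝓘(ℝ, B) (1 : G)) (x : M) : TangentSpace 𝓘(ℝ, E) x :=
  (mfderiv 𝓘(ℝ, B) 𝓘(ℝ, E) (fun h : G => h • x) 1 X : E)

/-- The form `i(X̃_p) ⋯ i(X̃_1) θ` of degree `q` on `M`, where `X̃_i` is the fundamental vector
field of `X_i`. -/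
def contractFundamental {q p : ℕ} (X : Fin p → TangentSpace 𝓘(ℝ, B) (1 : G))
    (θ : RawForm E M (q + p)) : RawForm E M q := fun x =>
  contract (V := E) p (fun i => fundamentalField E M (X i) x) (θ x)

/-- `f` is the map `f_γ : Ω(M) → Ω(G)`: for `θ ∈ Ω^{q+p}(M)`, `X_1, …, X_p ∈ T_e G` and `g ∈ G`,
`f(θ)(X_1^r, …, X_p^r)(g) = ∫_γ φ_g^* (i(X̃_p) ⋯ i(X̃_1) θ)`. As the component of degree `p` of
`f θ` depends only on the component of degree `q + p` of `θ`, forms of degree less than `q` are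
sent to `0`. -/
def IsFGamma {q : ℕ} (γ : SmoothChain E M q) (f : DeRham E M →ₗ[ℝ] DeRham B G) : Prop :=
  ∀ (θ : DeRham E M) (p : ℕ) (X : Fin p → TangentSpace 𝓘(ℝ, B) (1 : G)) (g : G),
    (f θ p).1 g (fun i => rightInvariantField (X i) g) =
      chainIntegral γ (pullback (E := E) (fun x : M => g • x)
        (contractFundamental X (θ (q + p)).1))

/-- The map `c ↦ f ∘ c` on cochains. -/
def compCochain (f : DeRham E M →ₗ[ℝ] DeRham B G) (s : ℕ) :
    Cochain G (DeRham E M) s →ₗ[ℝ] Cochain G (DeRham B G) s where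
  toFun c := fun g => f (c g)
  map_add' c c' := by
    funext g
    exact map_add f (c g) (c' g)
  map_smul' a c := by
    funext g
    exact map_smul f a (c g)

end FGamma

end EquivForms

end

open EquivForms

namespace EquivForms

open MeasureTheory

/-! ### The divergence theorem on the standard corner simplex -/

/-! For a simplex `σ` of `γ`, consider the orbit map `Ψ(g, t) = g • σ(t)` from `G × Δ` to `M`. The
chain rule applied to `h • (g • x) = (h * g) • x` shows that the fundamental field of `X` at `g • x`
is the image of `X^r(g)` under the derivative of `h ↦ h • x` (`fundamentalField_smul`). Hence
`f_γ(ω)` is the sum over the simplices of the fibre integrals of `Ψ^*ω` along `G × Δ → G`, with base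
vectors placed before fibre vectors. The predicate `IsChainForm` says this for arbitrary tangent
vectors of `G`; as right invariant fields fill every tangent space, it is equivalent to the defining
formula (`isFGamma_iff`), and uniqueness is immediate.

In a chart of `G` the fibre integral is an integral over a fixed compact simplex of a function
depending smoothly on a parameter. It is therefore a smooth form, and its derivatives are taken
under the integral sign (`contDiffOn_integral`, `extDeriv_fibreIntegral`).

For `d`, pull back `dω = d(Ψ^*ω)` and split the derivatives into base and fibre directions. The base
part is `d` of the fibre integral; the fibre part becomes, by Stokes on the simplex
(`fibreDerivIntegral_succ`), an alternating sum of integrals over the faces. Summed over `γ` the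
latter is the integral over `∂γ = 0` (`sum_faceIntegral_eq_zero`). With no base vectors the same
argument shows that exact forms integrate to zero over `g • γ`, which is the degree zero case.

Equivariance is the chain rule for `(g * h) • x = g • (h • x)`. Compatibility with the differentials
of the double complexes then follows formally, `f_γ` being linear, equivariant and compatible with
`d`. -/

lemma isClosed_cornerSimplex (q : ℕ) : IsClosed (cornerSimplex q) := by
  have h : cornerSimplex q = (⋂ i, {t | 0 ≤ t i}) ∩ {t | ∑ i, t i ≤ 1} := by
    ext t; simp [cornerSimplex]
  rw [h]
  refine (isClosed_iInter fun i => isClosed_le continuous_const (continuous_apply i)).inter ?_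
  exact isClosed_le (by fun_prop) continuous_const

lemma cornerSimplex_le_one {q : ℕ} {t : Fin q → ℝ} (ht : t ∈ cornerSimplex q) (i : Fin q) :
    t i ≤ 1 :=
  (Finset.single_le_sum (fun j _ => ht.1 j) (Finset.mem_univ i)).trans ht.2

lemma isCompact_cornerSimplex (q : ℕ) : IsCompact (cornerSimplex q) := by
  refine (isCompact_Icc (a := (0 : Fin q → ℝ)) (b := 1)).of_isClosed_subset
    (isClosed_cornerSimplex q) fun t ht => ⟨fun i => ht.1 i, fun i => cornerSimplex_le_one ht i⟩

lemma measurableSet_cornerSimplex (q : ℕ) : MeasurableSet (cornerSimplex q) :=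
  (isClosed_cornerSimplex q).measurableSet

lemma convex_cornerSimplex (q : ℕ) : Convex ℝ (cornerSimplex q) := by
  intro s hs t ht a b ha hb hab
  refine ⟨fun i => ?_, ?_⟩
  · have h1 := hs.1 i
    have h2 := ht.1 i
    simp only [Pi.add_apply, Pi.smul_apply, smul_eq_mul]
    positivity
  · simp only [Pi.add_apply, Pi.smul_apply, smul_eq_mul, Finset.sum_add_distrib,
      ← Finset.mul_sum]
    nlinarith [hs.2, ht.2]

/-- A convex set with nonempty interior. This makes the derivative within the simplex, used to
define the integral, agree with that of any smooth extension. -/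
lemma uniqueDiffOn_cornerSimplex (q : ℕ) : UniqueDiffOn ℝ (cornerSimplex q) := by
  refine uniqueDiffOn_convex (convex_cornerSimplex q) ?_
  have hopen : IsOpen ((⋂ i, {t : Fin q → ℝ | 0 < t i}) ∩ {t | ∑ i, t i < 1}) := by
    refine (isOpen_iInter_of_finite fun i =>
      isOpen_lt continuous_const (continuous_apply i)).inter ?_
    exact isOpen_lt (by fun_prop) continuous_const
  have hsub : (⋂ i, {t : Fin q → ℝ | 0 < t i}) ∩ {t | ∑ i, t i < 1} ⊆ cornerSimplex q :=
    fun t ht => ⟨fun i => (Set.mem_iInter.1 ht.1 i).le, le_of_lt ht.2⟩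
  -- The barycentre: all `q + 1` barycentric coordinates are equal, hence positive.
  refine ⟨fun _ => ((q : ℝ) + 1)⁻¹, interior_maximal hsub hopen ⟨?_, ?_⟩⟩
  · simp only [Set.mem_iInter, Set.mem_ofPred_eq]
    intro _
    positivity
  · have h : (q : ℝ) * ((q : ℝ) + 1)⁻¹ < 1 := by
      rw [← div_eq_mul_inv, div_lt_one (by positivity)]
      linarith
    simpa using h

lemma insertNth_mem_cornerSimplex {n : ℕ} (i : Fin (n + 1)) (x : ℝ) (s : Fin n → ℝ) :
    i.insertNth x s ∈ cornerSimplex (n + 1) ↔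
      s ∈ cornerSimplex n ∧ 0 ≤ x ∧ x ≤ 1 - ∑ j, s j := by
  have h : ∑ j, (i.insertNth x s : Fin (n + 1) → ℝ) j = x + ∑ j, s j := by
    rw [Fin.sum_univ_succAbove _ i]; simp
  simp only [cornerSimplex, Set.mem_ofPred_eq, h]
  rw [Fin.forall_iff_succAbove i]
  simp only [Fin.insertNth_apply_same, Fin.insertNth_apply_succAbove]
  constructor
  · rintro ⟨⟨h1, h2⟩, h3⟩
    exact ⟨⟨h2, by linarith⟩, h1, by linarith⟩
  · rintro ⟨⟨h1, h2⟩, h3, h4⟩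
    exact ⟨⟨h3, h1⟩, by linarith⟩

/-- The integral over the corner simplex, by integrating first over the `i`-th coordinate. -/
lemma integral_cornerSimplex_succ {n : ℕ} (i : Fin (n + 1)) {h : (Fin (n + 1) → ℝ) → ℝ}
    (hh : ContinuousOn h (cornerSimplex (n + 1))) :
    ∫ t in cornerSimplex (n + 1), h t =
      ∫ s in cornerSimplex n, ∫ x in (0 : ℝ)..(1 - ∑ j, s j), h (i.insertNth x s) := by
  have hint : Integrable ((cornerSimplex (n + 1)).indicator h) := by
    rw [integrable_indicator_iff (measurableSet_cornerSimplex _)]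
    exact hh.integrableOn_compact (isCompact_cornerSimplex _)
  have hmp := (volume_preserving_piFinSuccAbove (fun _ : Fin (n + 1) => ℝ) i).symm _
  rw [← integral_indicator (measurableSet_cornerSimplex _),
    ← hmp.integral_comp (MeasurableEquiv.measurableEmbedding _)]
  have hint' := (hmp.integrable_comp_emb (MeasurableEquiv.measurableEmbedding _)).2 hint
  change ∫ z, ((cornerSimplex (n + 1)).indicator h ∘
    (MeasurableEquiv.piFinSuccAbove (fun _ => ℝ) i).symm) z = _
  rw [Measure.volume_eq_prod, integral_prod_symm _ hint',
    ← integral_indicator (measurableSet_cornerSimplex _)]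
  refine integral_congr_ae (Filter.Eventually.of_forall fun s => ?_)
  have hind : ∀ x : ℝ, ((cornerSimplex (n + 1)).indicator h ∘
      (MeasurableEquiv.piFinSuccAbove (fun _ => ℝ) i).symm) (x, s) =
      (cornerSimplex (n + 1)).indicator h (i.insertNth x s) := fun _ => rfl
  simp only [hind, Set.indicator]
  by_cases hs : s ∈ cornerSimplex n
  · have hle : (0 : ℝ) ≤ 1 - ∑ j, s j := by linarith [hs.2]
    rw [if_pos hs, intervalIntegral.integral_of_le hle, ← integral_Icc_eq_integral_Ioc,
      ← integral_indicator measurableSet_Icc]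
    refine integral_congr_ae (Filter.Eventually.of_forall fun x => ?_)
    simp only [insertNth_mem_cornerSimplex, hs, true_and, Set.indicator, Set.mem_Icc]
  · simp [insertNth_mem_cornerSimplex, hs]

/-- Fundamental theorem of calculus along the `i`-th coordinate of the corner simplex. -/
lemma integral_fderiv_single_cornerSimplex {n : ℕ} (i : Fin (n + 1)) {h : (Fin (n + 1) → ℝ) → ℝ}
    {U : Set (Fin (n + 1) → ℝ)} (hU : IsOpen U) (hsub : cornerSimplex (n + 1) ⊆ U)
    (hh : ContDiffOn ℝ 1 h U) :
    ∫ t in cornerSimplex (n + 1), fderiv ℝ h t (Pi.single i 1) =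
      ∫ s in cornerSimplex n, (h (i.insertNth (1 - ∑ j, s j) s) - h (i.insertNth 0 s)) := by
  have hc : ContinuousOn (fun t => fderiv ℝ h t (Pi.single i 1)) U :=
    (hh.continuousOn_fderiv_of_isOpen hU le_rfl).clm_apply continuousOn_const
  rw [integral_cornerSimplex_succ i (hc.mono hsub)]
  refine setIntegral_congr_fun (measurableSet_cornerSimplex _) fun s hs => ?_
  have hle : (0 : ℝ) ≤ 1 - ∑ j, s j := by linarith [hs.2]
  have hmem : ∀ x ∈ Set.uIcc (0 : ℝ) (1 - ∑ j, s j), i.insertNth x s ∈ U := fun x hx => by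
    rw [Set.uIcc_of_le hle] at hx
    exact hsub ((insertNth_mem_cornerSimplex i x s).2 ⟨hs, hx.1, hx.2⟩)
  have hins : ∀ x : ℝ, HasDerivAt (fun x : ℝ => (i.insertNth x s : Fin (n + 1) → ℝ))
      (Pi.single i 1) x := fun x => by
    rw [hasDerivAt_pi]
    refine (Fin.forall_iff_succAbove i).2 ⟨?_, fun j => ?_⟩
    · simpa using hasDerivAt_id' x
    · simpa [Fin.succAbove_ne] using hasDerivAt_const x (s j)
  have hcont : Continuous fun x : ℝ => (i.insertNth x s : Fin (n + 1) → ℝ) :=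
    continuous_iff_continuousAt.2 fun x => (hins x).continuousAt
  refine intervalIntegral.integral_eq_sub_of_hasDerivAt
    (f := fun x => h (i.insertNth x s)) (fun x hx => ?_) ?_
  · exact ((hh.contDiffAt (hU.mem_nhds (hmem x hx))).differentiableAt
      (by simp)).hasFDerivAt.comp_hasDerivAt x (hins x)
  · exact (hc.comp hcont.continuousOn hmem).intervalIntegrable

/-- Exchanging the `i`-th barycentric coordinate with the zeroth one preserves the volume. -/
lemma measurePreserving_update_one_sub_sum {n : ℕ} (i : Fin n) :
    MeasurePreserving (fun s : Fin n → ℝ => Function.update s i (1 - ∑ j, s j)) := by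
  -- The map is affine with linear part `L`. Since `L` is an involution, its determinant squares to
  -- one, and no determinant has to be computed.
  let L : (Fin n → ℝ) →ₗ[ℝ] (Fin n → ℝ) :=
    { toFun := fun s => Function.update s i (-∑ j, s j)
      map_add' := fun s t => by
        ext k
        rcases eq_or_ne k i with rfl | hk
        · simp [Finset.sum_add_distrib]; ring
        · simp [hk]
      map_smul' := fun a s => by
        ext k
        rcases eq_or_ne k i with rfl | hk
        · simp [Finset.mul_sum]
        · simp [hk] }
  have hsum : ∀ s : Fin n → ℝ, ∑ j, L s j = -s i := fun s => by
    change ∑ j, Function.update s i (-∑ j, s j) j = -s i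
    rw [Finset.sum_update_of_mem (Finset.mem_univ i),
      ← Finset.sum_sdiff (Finset.subset_univ {i}) (f := s)]
    simp
    ring
  have hLL : L ∘ₗ L = LinearMap.id := by
    ext s k
    change Function.update (L _) i (-∑ j, L _ j) k = _
    rw [hsum]
    rcases eq_or_ne k i with rfl | hk
    · simp
    · simp [hk, L]
  have hdet : LinearMap.det L * LinearMap.det L = 1 := by
    rw [← LinearMap.det_comp, hLL, LinearMap.det_id]
  have habs : |LinearMap.det L| = 1 := by
    rcases mul_self_eq_one_iff.1 hdet with h | h <;> simp [h]
  have hL : MeasurePreserving L := by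
    refine ⟨L.toContinuousLinearMap.continuous.measurable, ?_⟩
    rw [Real.map_linearMap_volume_pi_eq_smul_volume_pi (left_ne_zero_of_mul_eq_one hdet), abs_inv,
      habs]
    simp
  have he : (fun s : Fin n → ℝ => Function.update s i (1 - ∑ j, s j)) =
      (fun s => Pi.single i 1 + s) ∘ L := by
    funext s
    ext k
    rcases eq_or_ne k i with rfl | hk
    · simp [L]; ring
    · simp [hk, L]
  rw [he]
  exact (measurePreserving_add_left volume _).comp hL

/-- Both sides integrate over the slanted face, parametrized by all coordinates but one. Moving the
omitted coordinate one place further is the substitution of `measurePreserving_update_one_sub_sum`,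
whence the induction on `i`. -/
lemma integral_insertNth_one_sub_sum {n : ℕ} (h : (Fin (n + 1) → ℝ) → ℝ) (i : Fin (n + 1)) :
    ∫ s in cornerSimplex n, h (i.insertNth (1 - ∑ j, s j) s) =
      ∫ s in cornerSimplex n, h (Fin.cons (1 - ∑ j, s j) s) := by
  induction i using Fin.induction with
  | zero => simp
  | succ i ih =>
    rw [← ih]
    have hsum : ∀ s : Fin n → ℝ, ∑ j, Function.update s i (1 - ∑ j, s j) j = 1 - s i := fun s => by
      rw [Finset.sum_update_of_mem (Finset.mem_univ i),
        ← Finset.sum_sdiff (Finset.subset_univ {i}) (f := s)]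
      simp
    have hinv : ∀ s : Fin n → ℝ, Function.update (Function.update s i (1 - ∑ j, s j)) i
        (1 - ∑ k, Function.update s i (1 - ∑ j, s j) k) = s := fun s => by
      rw [hsum]; simp
    have hpre : ∀ s ∈ cornerSimplex n,
        Function.update s i (1 - ∑ j, s j) ∈ cornerSimplex n := fun s hs => by
      refine ⟨fun k => ?_, ?_⟩
      · rcases eq_or_ne k i with rfl | hk
        · simpa using hs.2
        · simpa [hk] using hs.1 k
      · rw [hsum]; linarith [hs.1 i]
    have hemb : MeasurableEmbedding
        (fun s : Fin n → ℝ => Function.update s i (1 - ∑ j, s j)) :=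
      (MeasurableEquiv.ofInvolutive
        (fun s : Fin n → ℝ => Function.update s i (1 - ∑ j, s j)) hinv
        (measurePreserving_update_one_sub_sum i).measurable).measurableEmbedding
    have hset : (fun s : Fin n → ℝ => Function.update s i (1 - ∑ j, s j)) ⁻¹' cornerSimplex n =
        cornerSimplex n := by
      ext s
      refine ⟨fun hs => ?_, hpre s⟩
      have := hpre _ hs
      rwa [hinv] at this
    rw [← (measurePreserving_update_one_sub_sum i).setIntegral_preimage_emb hemb, hset]
    refine setIntegral_congr_fun (measurableSet_cornerSimplex _) fun s _ => ?_
    simp only [hsum, sub_sub_cancel]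
    congr 1
    rw [Fin.insertNth_eq_iff]
    constructor
    · conv_rhs => rw [← Fin.succAbove_castSucc_self i, Fin.insertNth_apply_succAbove]
    · ext j
      rcases lt_trichotomy j i with hj | rfl | hj
      · simp [Fin.removeNth, hj.ne, Fin.succAbove_succ_of_le, hj.le,
          ← Fin.succAbove_castSucc_of_lt _ _ hj]
      · simp [Fin.removeNth]
      · simp [Fin.removeNth, hj.ne', Fin.succAbove_succ_of_lt, hj,
          ← Fin.succAbove_castSucc_of_le _ _ hj.le]

/-- Stokes' theorem for an `n`-form on the `(n + 1)`-simplex, in terms of the coefficients of the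
form. -/
theorem integral_divergence_cornerSimplex {n : ℕ} {β : Fin (n + 1) → (Fin (n + 1) → ℝ) → ℝ}
    {U : Set (Fin (n + 1) → ℝ)} (hU : IsOpen U) (hsub : cornerSimplex (n + 1) ⊆ U)
    (hβ : ∀ i, ContDiffOn ℝ 1 (β i) U) :
    ∫ t in cornerSimplex (n + 1),
        ∑ i : Fin (n + 1), (-1 : ℝ) ^ (i : ℕ) * fderiv ℝ (β i) t (Pi.single i 1) =
      (∫ s in cornerSimplex n,
          ∑ i : Fin (n + 1), (-1 : ℝ) ^ (i : ℕ) * β i (Fin.cons (1 - ∑ j, s j) s)) +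
        ∑ i : Fin (n + 1), (-1 : ℝ) ^ ((i : ℕ) + 1) *
          ∫ s in cornerSimplex n, β i (i.insertNth 0 s) := by
  have hc : ∀ i, IntegrableOn (fun t => fderiv ℝ (β i) t (Pi.single i 1))
      (cornerSimplex (n + 1)) := fun i =>
    ((((hβ i).continuousOn_fderiv_of_isOpen hU le_rfl).clm_apply continuousOn_const).mono
      hsub).integrableOn_compact (isCompact_cornerSimplex _)
  have hb : ∀ (i k : Fin (n + 1)) (y : (Fin n → ℝ) → ℝ), Continuous y →
      (∀ s ∈ cornerSimplex n, 0 ≤ y s ∧ y s ≤ 1 - ∑ j, s j) →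
      IntegrableOn (fun s => β i (k.insertNth (y s) s)) (cornerSimplex n) := fun i k y hy hys => by
    refine ((hβ i).continuousOn.comp ?_ fun s hs => hsub
      ((insertNth_mem_cornerSimplex k _ s).2 ⟨hs, hys s hs⟩)).integrableOn_compact
      (isCompact_cornerSimplex _)
    exact (Continuous.finInsertNth (A := fun _ => ℝ) k hy continuous_id).continuousOn
  have hsum : Continuous fun s : Fin n → ℝ => 1 - ∑ j, s j := by fun_prop
  have h1 : ∀ i k : Fin (n + 1), IntegrableOn (fun s : Fin n → ℝ => β i (k.insertNth (1 - ∑ j, s j) s))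
      (cornerSimplex n) := fun i k => hb i k _ hsum fun s hs => ⟨by linarith [hs.2], le_rfl⟩
  have h0 : ∀ i k : Fin (n + 1), IntegrableOn (fun s : Fin n → ℝ => β i (k.insertNth 0 s))
      (cornerSimplex n) := fun i k =>
    hb i k _ continuous_const fun s hs => ⟨le_rfl, by linarith [hs.2]⟩
  have h1' : ∀ i, IntegrableOn (fun s : Fin n → ℝ => β i (Fin.cons (1 - ∑ j, s j) s))
      (cornerSimplex n) := fun i => by simpa using h1 i 0
  rw [integral_finsetSum _ fun i _ => (hc i).const_mul _,
    integral_finsetSum _ fun i _ => (h1' i).const_mul _, ← Finset.sum_add_distrib]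
  refine Finset.sum_congr rfl fun i _ => ?_
  -- The upper endpoints of the segments sweep out the slanted face, which is face `0`; the lower
  -- ones sweep out face `i + 1`, which explains its sign.
  rw [integral_const_mul, integral_const_mul, integral_fderiv_single_cornerSimplex i hU hsub (hβ i),
    integral_sub (h1 i i) (h0 i i), integral_insertNth_one_sub_sum (β i) i]
  ring

/-! ### Integrals depending smoothly on a parameter -/

section ParametricIntegral

/-- The tube lemma around `{b} × K`. It supplies the constant that dominates the derivatives when
differentiating under the integral sign. -/
lemma exists_bound_near_compact {H V Z : Type*} [TopologicalSpace H] [TopologicalSpace V]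
    [NormedAddCommGroup Z] {T : Set H} {U K : Set V} (hT : IsOpen T)
    (hU : IsOpen U) (hK : IsCompact K) (hKU : K ⊆ U) {F : H × V → Z}
    (hF : ContinuousOn F (T ×ˢ U)) {b : H} (hb : b ∈ T) :
    ∃ C : ℝ, ∃ s ∈ 𝓝 b, s ⊆ T ∧ ∀ x ∈ s, ∀ t ∈ K, ‖F (x, t)‖ ≤ C := by
  have hcomp : IsCompact (({b} : Set H) ×ˢ K) := isCompact_singleton.prod hK
  have hsub : ({b} : Set H) ×ˢ K ⊆ T ×ˢ U :=
    Set.prod_mono (Set.singleton_subset_iff.2 hb) hKU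
  obtain ⟨C, hC⟩ := hcomp.exists_bound_of_continuousOn (hF.mono hsub)
  have hopen : IsOpen ((T ×ˢ U) ∩ (fun z => ‖F z‖) ⁻¹' Set.Iio (C + 1)) :=
    hF.norm.isOpen_inter_preimage (hT.prod hU) isOpen_Iio
  obtain ⟨s, v, hs, -, hbs, hKv, hsv⟩ := generalized_tube_lemma isCompact_singleton hK hopen
    fun z hz => ⟨hsub hz, (hC z hz).trans_lt (lt_add_one C)⟩
  refine ⟨C + 1, s ∩ T, (hs.inter hT).mem_nhds ⟨hbs rfl, hb⟩, Set.inter_subset_right,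
    fun x hx t ht => ?_⟩
  exact le_of_lt (hsv ⟨hx.1, hKv ht⟩ : (x, t) ∈ _).2

lemma integrableOn_slice {H V Z : Type*} [TopologicalSpace H] [TopologicalSpace V]
    [MeasurableSpace V] [T2Space V] [OpensMeasurableSpace V] {μ : Measure V}
    [IsFiniteMeasureOnCompacts μ] [NormedAddCommGroup Z] [NormedSpace ℝ Z]
    {T : Set H} {U K : Set V} (hK : IsCompact K)
    (hKU : K ⊆ U) {F : H × V → Z} (hF : ContinuousOn F (T ×ˢ U)) {b : H} (hb : b ∈ T) :
    IntegrableOn (fun t => F (b, t)) K μ := by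
  refine ContinuousOn.integrableOn_compact hK (hF.comp (by fun_prop) fun t ht => ⟨hb, hKU ht⟩)

universe u

variable {H : Type u} [NormedAddCommGroup H] [NormedSpace ℝ H]
  {V : Type*} [NormedAddCommGroup V] [NormedSpace ℝ V] [MeasurableSpace V] [BorelSpace V]
  {μ : Measure V} [IsFiniteMeasureOnCompacts μ]
  {T : Set H} {U K : Set V}

lemma hasFDerivAt_integral_of_contDiffOn {Z : Type*} [NormedAddCommGroup Z] [NormedSpace ℝ Z]
    (hT : IsOpen T) (hU : IsOpen U) (hK : IsCompact K) (hKU : K ⊆ U) {F : H × V → Z}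
    (hF : ContDiffOn ℝ 1 F (T ×ˢ U)) {b : H} (hb : b ∈ T) :
    HasFDerivAt (fun x => ∫ t in K, F (x, t) ∂μ)
      (∫ t in K, (fderiv ℝ F (b, t)).comp (ContinuousLinearMap.inl ℝ H V) ∂μ) b := by
  have hF' : ContinuousOn (fun z => (fderiv ℝ F z).comp (ContinuousLinearMap.inl ℝ H V))
      (T ×ˢ U) := (hF.continuousOn_fderiv_of_isOpen (hT.prod hU) le_rfl).clm_comp
        continuousOn_const
  obtain ⟨C, s, hs, hsT, hC⟩ := exists_bound_near_compact hT hU hK hKU hF' hb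
  refine hasFDerivAt_integral_of_dominated_of_fderiv_le (bound := fun _ => C)
    (F := fun x t => F (x, t))
    (F' := fun x t => (fderiv ℝ F (x, t)).comp (ContinuousLinearMap.inl ℝ H V)) hs ?_
    (integrableOn_slice hK hKU hF.continuousOn hb)
    (integrableOn_slice (F := fun z => (fderiv ℝ F z).comp (ContinuousLinearMap.inl ℝ H V))
      hK hKU hF' hb).aestronglyMeasurable ?_ ?_ ?_
  · filter_upwards [hT.mem_nhds hb] with x hx
    exact (integrableOn_slice hK hKU hF.continuousOn hx).aestronglyMeasurable
  · filter_upwards [ae_restrict_mem hK.measurableSet] with t ht x hx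
    exact hC x hx t ht
  · have : IsFiniteMeasure (μ.restrict K) := ⟨by simpa using hK.measure_lt_top⟩
    exact integrable_const _
  · filter_upwards [ae_restrict_mem hK.measurableSet] with t ht x hx
    have hd : DifferentiableAt ℝ F (x, t) :=
      (hF.contDiffAt ((hT.prod hU).mem_nhds ⟨hsT hx, hKU ht⟩)).differentiableAt (by simp)
    exact hd.hasFDerivAt.comp x (hasFDerivAt_prodMk_left x t)

/-- An integral over a compact set of a function depending smoothly on a parameter depends
smoothly on this parameter. -/
theorem contDiffOn_integral {Z : Type u} [NormedAddCommGroup Z] [NormedSpace ℝ Z]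
    (hT : IsOpen T) (hU : IsOpen U) (hK : IsCompact K) (hKU : K ⊆ U) {F : H × V → Z}
    (hF : ContDiffOn ℝ ∞ F (T ×ˢ U)) : ContDiffOn ℝ ∞ (fun x => ∫ t in K, F (x, t) ∂μ) T := by
  refine contDiffOn_infty.2 fun n => ?_
  -- The derivative is an integral of the same kind with values in `H →L[ℝ] Z`, so the codomain must
  -- vary; `Z` lives in the universe of `H` for this reason.
  induction n generalizing Z with
  | zero =>
    refine contDiffOn_zero.2 fun b hb => ?_
    exact (hasFDerivAt_integral_of_contDiffOn hT hU hK hKU (hF.of_le (by simp))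
      hb).continuousAt.continuousWithinAt
  | succ n ih =>
    have hd := fun b (hb : b ∈ T) => hasFDerivAt_integral_of_contDiffOn (μ := μ) hT hU hK hKU
      (hF.of_le (by simp) : ContDiffOn ℝ 1 F (T ×ˢ U)) hb
    push_cast
    refine (contDiffOn_succ_iff_fderiv_of_isOpen hT).2
      ⟨fun b hb => (hd b hb).differentiableAt.differentiableWithinAt, by simp, ?_⟩
    refine (ih (F := fun z => (fderiv ℝ F z).comp (ContinuousLinearMap.inl ℝ H V)) ?_).congr
      fun b hb => (hd b hb).fderiv
    exact (hF.fderiv_of_isOpen (m := ∞) (hT.prod hU) (by simp)).clm_comp contDiffOn_const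

end ParametricIntegral

open ContinuousAlternatingMap

/-! ### Alternating maps evaluated on two blocks of vectors -/

section Splice

/-- The tuple of length `n` consisting of the first `p` terms of `Y` followed by terms of `e`. -/
def splice {W : Type*} (n p : ℕ) (Y e : ℕ → W) : Fin n → W :=
  fun j => if (j : ℕ) < p then Y j else e (j - p)

/-- The sequence `Y` with its `k`-th term omitted. -/
def skip {W : Type*} (k : ℕ) (Y : ℕ → W) : ℕ → W := fun j => if j < k then Y j else Y (j + 1)

/-- A tuple extended by zero to a sequence. -/
def extendZero {W : Type*} [Zero W] {p : ℕ} (Y : Fin p → W) : ℕ → W :=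
  fun j => if h : j < p then Y ⟨j, h⟩ else 0

lemma extendZero_val {W : Type*} [Zero W] {p : ℕ} (Y : Fin p → W) (i : Fin p) :
    extendZero Y i = Y i := by
  simp [extendZero]

lemma splice_congr {W : Type*} {n p q : ℕ} (h : n ≤ p + q) {Y Y' e e' : ℕ → W}
    (hY : ∀ j < p, Y j = Y' j) (he : ∀ j < q, e j = e' j) : splice n p Y e = splice n p Y' e' := by
  funext j
  simp only [splice]
  split_ifs with hj
  · exact hY _ hj
  · exact he _ (by omega)

lemma comp_splice {W W' : Type*} (f : W → W') (n p : ℕ) (Y e : ℕ → W) :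
    (fun j => f (splice n p Y e j)) = splice n p (fun k => f (Y k)) fun k => f (e k) := by
  funext j
  simp only [splice]
  split_ifs <;> rfl

lemma removeNth_splice_of_lt {W : Type*} {n p : ℕ} (Y e : ℕ → W) (i : Fin (n + 1))
    (hi : (i : ℕ) < p) :
    i.removeNth (splice (n + 1) p Y e) = splice n (p - 1) (skip i Y) e := by
  funext j
  simp only [Fin.removeNth, splice, skip, Fin.succAbove, Fin.lt_def, Fin.val_castSucc]
  split_ifs with h1 h2 h3 h4 h5 h6 <;> simp_all <;> first | omega | (congr 1; omega)

lemma removeNth_splice_of_le {W : Type*} {n p : ℕ} (Y e : ℕ → W) (i : Fin (n + 1))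
    (hi : p ≤ (i : ℕ)) :
    i.removeNth (splice (n + 1) p Y e) = splice n p Y (skip (i - p) e) := by
  funext j
  simp only [Fin.removeNth, splice, skip, Fin.succAbove, Fin.lt_def, Fin.val_castSucc]
  split_ifs with h1 h2 h3 h4 h5 h6 <;> simp_all <;> first | omega | (congr 1; omega)

variable {W : Type*} [NormedAddCommGroup W] [NormedSpace ℝ W]

/-- With `L` the derivative of a form, this separates the base and the fibre derivatives in its
exterior derivative; the sign `(-1)^p` comes from passing the first block. For `p = 0` the truncated
`p - 1` occurs only in an empty sum. -/
lemma alternatizeUncurryFin_splice {n p q : ℕ} (h : n + 1 = p + q)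
    (L : W →L[ℝ] W [⋀^Fin n]→L[ℝ] ℝ) (Y e : ℕ → W) :
    alternatizeUncurryFin L (splice (n + 1) p Y e) =
      ∑ i ∈ Finset.range p, (-1 : ℝ) ^ i * L (Y i) (splice n (p - 1) (skip i Y) e) +
        (-1 : ℝ) ^ p * ∑ k ∈ Finset.range q, (-1 : ℝ) ^ k * L (e k) (splice n p Y (skip k e)) := by
  rw [alternatizeUncurryFin_apply]
  have h1 : ∀ i : Fin (n + 1), (-1) ^ (i : ℕ) •
      L (splice (n + 1) p Y e i) (i.removeNth (splice (n + 1) p Y e)) =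
      (fun i : ℕ => if i < p then (-1 : ℝ) ^ i * L (Y i) (splice n (p - 1) (skip i Y) e)
        else (-1 : ℝ) ^ i * L (e (i - p)) (splice n p Y (skip (i - p) e))) i := by
    intro i
    dsimp only
    rw [zsmul_eq_mul]
    push_cast
    split_ifs with hi
    · rw [removeNth_splice_of_lt Y e i hi]
      simp [splice, hi]
    · rw [removeNth_splice_of_le Y e i (not_lt.1 hi)]
      simp [splice, hi]
  rw [Finset.sum_congr rfl fun i _ => h1 i, Fin.sum_univ_eq_sum_range (fun i : ℕ => if i < p
    then (-1 : ℝ) ^ i * L (Y i) (splice n (p - 1) (skip i Y) e)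
    else (-1 : ℝ) ^ i * L (e (i - p)) (splice n p Y (skip (i - p) e))), h, Finset.sum_range_add,
    Finset.mul_sum]
  congr 1
  · refine Finset.sum_congr rfl fun i hi => ?_
    rw [if_pos (Finset.mem_range.1 hi)]
  · refine Finset.sum_congr rfl fun k _ => ?_
    rw [if_neg (by omega), Nat.add_sub_cancel_left, pow_add, mul_assoc]

/-- Subtracting one vector from some of the others does not change the value of an alternating
map. -/
lemma map_sub_of_notMem {ι : Type*} [DecidableEq ι] (g : W [⋀^ι]→L[ℝ] ℝ) (w : ι → W)
    (i : ι) (s : Finset ι) (hi : i ∉ s) :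
    g (fun j => if j ∈ s then w j - w i else w j) = g w := by
  induction s using Finset.induction_on with
  | empty => simp
  | insert k s hk ih =>
    have hik : i ≠ k := fun h => hi (h ▸ Finset.mem_insert_self _ _)
    have his : i ∉ s := fun h => hi (Finset.mem_insert_of_mem h)
    have e1 : (fun j => if j ∈ insert k s then w j - w i else w j) =
        Function.update (fun j => if j ∈ s then w j - w i else w j) k (w k - w i) := by
      funext j
      rcases eq_or_ne j k with rfl | hj
      · simp
      · simp [hj]
    rw [e1, map_update_sub]
    have e2 : Function.update (fun j => if j ∈ s then w j - w i else w j) k (w k) =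
        fun j => if j ∈ s then w j - w i else w j := by
      rw [Function.update_eq_self_iff]
      simp [hk]
    have e3 : g (Function.update (fun j => if j ∈ s then w j - w i else w j) k (w i)) = 0 :=
      g.map_eq_zero_of_eq _ (i := i) (j := k) (by simp [hik, his]) hik
    rw [e2, ih his, e3, sub_zero]

/-- The expansion of an alternating map on the differences `e₁ - e₀, …, e_q - e₀`. -/
lemma map_splice_sub {n p q : ℕ} (h : n = p + q) (A : W [⋀^Fin n]→L[ℝ] ℝ) (Y e : ℕ → W) :
    A (splice n p Y fun k => e (k + 1) - e 0) =
      ∑ k ∈ Finset.range (q + 1), (-1 : ℝ) ^ k * A (splice n p Y (skip k e)) := by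
  -- Adjoin a real coordinate and alternatize its product with `A`. On the vectors `(0, Y k)` and
  -- `(1, e k)` this gives the alternating sum. Subtracting `(1, e 0)` from the later `(1, e k)`
  -- preserves the value and leaves a single nonzero term.
  let L : (ℝ × W) →L[ℝ] (ℝ × W) [⋀^Fin n]→L[ℝ] ℝ :=
    (ContinuousLinearMap.fst ℝ ℝ W).smulRight
      (A.compContinuousLinearMap (ContinuousLinearMap.snd ℝ ℝ W))
  have hL : ∀ z v, L z v = z.1 * A (fun j => (v j).2) := fun _ _ => rfl
  have hp : p < n + 1 := by omega
  have h1 := alternatizeUncurryFin_splice (n := n) (p := p) (q := q + 1) (by omega) L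
    (fun k => ((0 : ℝ), Y k)) (fun k => ((1 : ℝ), e k))
  have h2 := alternatizeUncurryFin_splice (n := n) (p := p) (q := q + 1) (by omega) L
    (fun k => ((0 : ℝ), Y k))
    (fun k => if k = 0 then ((1 : ℝ), e 0) else ((0 : ℝ), e k - e 0))
  have h3 := map_sub_of_notMem (alternatizeUncurryFin L)
    (splice (n + 1) p (fun k => ((0 : ℝ), Y k)) (fun k => ((1 : ℝ), e k))) ⟨p, hp⟩
    (Finset.univ.filter fun j => p < (j : ℕ)) (by simp)
  have h4 : (fun j => if j ∈ Finset.univ.filter fun j : Fin (n + 1) => p < (j : ℕ) then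
      splice (n + 1) p (fun k => ((0 : ℝ), Y k)) (fun k => ((1 : ℝ), e k)) j -
        splice (n + 1) p (fun k => ((0 : ℝ), Y k)) (fun k => ((1 : ℝ), e k)) ⟨p, hp⟩ else
      splice (n + 1) p (fun k => ((0 : ℝ), Y k)) (fun k => ((1 : ℝ), e k)) j) =
      splice (n + 1) p (fun k => ((0 : ℝ), Y k))
        (fun k => if k = 0 then ((1 : ℝ), e 0) else ((0 : ℝ), e k - e 0)) := by
    funext j
    rcases lt_trichotomy (j : ℕ) p with hj | hj | hj
    · simp [splice, hj, hj.not_gt]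
    · simp [splice, hj]
    · simp [splice, hj, hj.not_gt, Nat.sub_ne_zero_of_lt hj]
  rw [h4, h1, h2] at h3
  simp only [hL, comp_splice Prod.snd, zero_mul, mul_zero, Finset.sum_const_zero, zero_add,
    one_mul] at h3
  have h5 := mul_left_cancel₀ (pow_ne_zero p (by norm_num : (-1 : ℝ) ≠ 0)) h3
  have h6 : ∀ k : ℕ, (fun i => (skip k (fun k => ((1 : ℝ), e k)) i).2) = skip k e := fun k => by
    funext i; simp only [skip]; split_ifs <;> rfl
  simp only [h6] at h5
  rw [← h5, Finset.sum_range_succ']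
  simp [skip]

variable {B : Type*} [NormedAddCommGroup B] [NormedSpace ℝ B]

lemma splice_extendZero_update {n p : ℕ} [DecidableEq (Fin p)] (h : p ≤ n) (j : B →L[ℝ] W)
    (e : ℕ → W) (Y : Fin p → B) (i : Fin p) (z : B) :
    splice n p (fun k => j (extendZero (Function.update Y i z) k)) e =
      Function.update (splice n p (fun k => j (extendZero Y k)) e) (i.castLE h) (j z) := by
  funext k
  by_cases hk : (k : ℕ) < p
  · rcases eq_or_ne k (i.castLE h) with rfl | hne
    · simp [splice, extendZero]
    · have hne' : (⟨k, hk⟩ : Fin p) ≠ i := fun hki => hne (Fin.ext (by simp [← hki]))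
      simp [splice, extendZero, hk, hne, hne']
  · have hne : k ≠ i.castLE h := fun hki => hk (by simp [hki])
    simp [splice, hk, hne]

/-- An alternating map in `n` variables as an alternating map in its first `p` variables, the
remaining ones being given the values `e 0, e 1, …`. -/
noncomputable def spliceHead {n p : ℕ} (h : p ≤ n) (j : B →L[ℝ] W) (e : ℕ → W) :
    (W [⋀^Fin n]→L[ℝ] ℝ) →L[ℝ] B [⋀^Fin p]→L[ℝ] ℝ :=
  AlternatingMap.mkContinuousLinear
    { toFun := fun A =>
        { toFun := fun Y => A (splice n p (fun k => j (extendZero Y k)) e)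
          map_update_add' := fun Y i x y => by
            simp only [splice_extendZero_update h, map_add, ContinuousAlternatingMap.map_update_add]
          map_update_smul' := fun Y i c x => by
            simp only [splice_extendZero_update h, map_smul, ContinuousAlternatingMap.map_update_smul]
          map_eq_zero_of_eq' := fun Y i k hik hne => by
            refine A.map_eq_zero_of_eq _ (i := i.castLE h) (j := k.castLE h) ?_ ?_
            · simp [splice, extendZero_val, hik]
            · simpa [Fin.ext_iff] using hne }
      map_add' := fun _ _ => rfl
      map_smul' := fun _ _ => rfl }
    (‖j‖ ^ p * ∏ k ∈ Finset.range (n - p), ‖e k‖) fun A Y => by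
      obtain ⟨q, rfl⟩ := Nat.exists_eq_add_of_le h
      refine (A.le_opNorm _).trans ?_
      have h1 : ∏ i, ‖splice (p + q) p (fun k => j (extendZero Y k)) e i‖ =
          (∏ i : Fin p, ‖j (Y i)‖) * ∏ k ∈ Finset.range q, ‖e k‖ := by
        rw [Fin.prod_univ_add, Finset.prod_range]
        simp [splice, extendZero]
      have h2 : ∏ i : Fin p, ‖j (Y i)‖ ≤ ‖j‖ ^ p * ∏ i, ‖Y i‖ := by
        refine (Finset.prod_le_prod (fun i _ => norm_nonneg _)
          fun i _ => j.le_opNorm (Y i)).trans (le_of_eq ?_)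
        simp [Finset.prod_mul_distrib]
      rw [h1, Nat.add_sub_cancel_left]
      have h3 : 0 ≤ ∏ k ∈ Finset.range q, ‖e k‖ := Finset.prod_nonneg fun _ _ => norm_nonneg _
      calc ‖A‖ * ((∏ i : Fin p, ‖j (Y i)‖) * ∏ k ∈ Finset.range q, ‖e k‖)
          ≤ ‖A‖ * ((‖j‖ ^ p * ∏ i, ‖Y i‖) * ∏ k ∈ Finset.range q, ‖e k‖) := by gcongr
        _ = ‖j‖ ^ p * (∏ k ∈ Finset.range q, ‖e k‖) * ‖A‖ * ∏ i, ‖Y i‖ := by ring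

lemma spliceHead_apply {n p : ℕ} (h : p ≤ n) (j : B →L[ℝ] W) (e : ℕ → W)
    (A : W [⋀^Fin n]→L[ℝ] ℝ) (Y : Fin p → B) :
    spliceHead h j e A Y = A (splice n p (fun k => j (extendZero Y k)) e) := rfl

end Splice

/-! ### Fibre integrals of forms over a simplex in coordinates -/

section Fibre

/-- The standard basis of `ℝ^q` as a sequence. -/
def stdVec (q : ℕ) : ℕ → Fin q → ℝ := fun k j => if (j : ℕ) = k then 1 else 0

lemma stdVec_val {q : ℕ} (k : Fin q) : stdVec q k = Pi.single k 1 := by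
  funext j
  simp [stdVec, Pi.single_apply, Fin.ext_iff]

/-- The `j`-th face of the corner simplex. -/
def faceMap {q : ℕ} (j : Fin (q + 2)) (s : Fin q → ℝ) : Fin (q + 1) → ℝ :=
  Fin.tail (j.insertNth (0 : ℝ) (bary s) : Fin (q + 2) → ℝ)

lemma faceMap_zero {q : ℕ} (s : Fin q → ℝ) : faceMap 0 s = Fin.cons (1 - ∑ i, s i) s := by
  simp [faceMap, bary]

lemma faceMap_succ {q : ℕ} (i : Fin (q + 1)) (s : Fin q → ℝ) :
    faceMap i.succ s = i.insertNth 0 s := by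
  refine (Fin.eq_insertNth_iff).2 ⟨?_, ?_⟩
  · simp [faceMap, Fin.tail]
  · funext k
    simp [Fin.removeNth, faceMap, Fin.tail, ← Fin.succ_succAbove_succ, bary]

lemma faceMap_mem {q : ℕ} (j : Fin (q + 2)) {s : Fin q → ℝ} (hs : s ∈ cornerSimplex q) :
    faceMap j s ∈ cornerSimplex (q + 1) := by
  have h : 0 ≤ 1 - ∑ i, s i := by linarith [hs.2]
  refine Fin.cases ?_ (fun i => ?_) j
  · rw [faceMap_zero, ← Fin.insertNth_zero', insertNth_mem_cornerSimplex]
    exact ⟨hs, h, le_rfl⟩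
  · rw [faceMap_succ, insertNth_mem_cornerSimplex]
    exact ⟨hs, le_rfl, h⟩

/-- The linear part of `faceMap j`. -/
noncomputable def faceLin {q : ℕ} (j : Fin (q + 2)) : (Fin q → ℝ) →L[ℝ] (Fin (q + 1) → ℝ) :=
  LinearMap.toContinuousLinearMap
    { toFun := fun v => faceMap j v - faceMap j 0
      map_add' := fun v w => by
        refine Fin.cases ?_ (fun i => ?_) j
        · funext k
          refine Fin.cases ?_ (fun k => ?_) k <;>
            simp [faceMap_zero, Finset.sum_add_distrib]; ring
        · funext k
          revert k
          refine (Fin.forall_iff_succAbove i).2 ⟨?_, fun k => ?_⟩ <;> simp [faceMap_succ]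
      map_smul' := fun c v => by
        refine Fin.cases ?_ (fun i => ?_) j
        · funext k
          refine Fin.cases ?_ (fun k => ?_) k <;>
            simp [faceMap_zero, ← Finset.mul_sum]
        · funext k
          revert k
          refine (Fin.forall_iff_succAbove i).2 ⟨?_, fun k => ?_⟩ <;> simp [faceMap_succ] }

lemma faceLin_apply {q : ℕ} (j : Fin (q + 2)) (v : Fin q → ℝ) :
    faceLin j v = faceMap j v - faceMap j 0 := rfl

lemma faceMap_eq {q : ℕ} (j : Fin (q + 2)) :
    (faceMap j : (Fin q → ℝ) → _) = fun s => faceLin j s + faceMap j 0 := by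
  funext s
  rw [faceLin_apply, sub_add_cancel]

lemma hasFDerivAt_faceMap {q : ℕ} (j : Fin (q + 2)) (s : Fin q → ℝ) :
    HasFDerivAt (faceMap j) (faceLin j) s := by
  rw [faceMap_eq]
  exact (faceLin j).hasFDerivAt.add_const _

/-- The edges of the slanted face are differences of basis vectors; this is what makes
`map_splice_sub` necessary in Stokes' theorem. -/
lemma faceLin_zero_stdVec {q k : ℕ} (hk : k < q) :
    faceLin 0 (stdVec q k) = stdVec (q + 1) (k + 1) - stdVec (q + 1) 0 := by
  have h : ∑ i, stdVec q k i = 1 := by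
    rw [show stdVec q k = Pi.single ⟨k, hk⟩ 1 from stdVec_val ⟨k, hk⟩]
    simp
  funext i
  refine Fin.cases ?_ (fun i => ?_) i
  · simp only [faceLin_apply, faceMap_zero, Pi.sub_apply, Fin.cons_zero, h]
    simp [stdVec]
  · simp [faceLin_apply, faceMap_zero, stdVec]

lemma faceLin_succ_stdVec {q : ℕ} (i : Fin (q + 1)) (k : ℕ) :
    faceLin i.succ (stdVec q k) = skip i (stdVec (q + 1)) k := by
  funext l
  revert l
  refine (Fin.forall_iff_succAbove i).2 ⟨?_, fun l => ?_⟩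
  · simp only [faceLin_apply, faceMap_succ, skip]
    split_ifs with h <;> simp [stdVec] <;> omega
  · have hl : ((i.succAbove l : Fin (q + 1)) : ℕ) = if (l : ℕ) < i then (l : ℕ) else l + 1 := by
      simp only [Fin.succAbove, Fin.lt_def, Fin.val_castSucc]
      split_ifs <;> rfl
    simp only [faceLin_apply, faceMap_succ, skip, Pi.sub_apply, Fin.insertNth_apply_succAbove,
      Pi.zero_apply, sub_zero]
    split_ifs with h <;> simp only [stdVec, hl] <;> grind

variable {B : Type*} [NormedAddCommGroup B] [NormedSpace ℝ B] {q n : ℕ}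
  {T : Set B} {U : Set (Fin q → ℝ)} {A : B × (Fin q → ℝ) → (B × (Fin q → ℝ)) [⋀^Fin n]→L[ℝ] ℝ}

variable (B) in
/-- The standard basis of the fibre of `B × ℝ^q → B`. -/
def fibreVec (q : ℕ) : ℕ → B × (Fin q → ℝ) := fun k => (0, stdVec q k)

/-- The integral over the simplex in the fibre of `B × ℝ^q → B` of an `n`-form, as a form of
degree `p ≤ n`. -/
noncomputable def fibreIntegral {p : ℕ} (h : p ≤ n)
    (A : B × (Fin q → ℝ) → (B × (Fin q → ℝ)) [⋀^Fin n]→L[ℝ] ℝ) (b : B) : B [⋀^Fin p]→L[ℝ] ℝ :=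
  ∫ t in cornerSimplex q, spliceHead h (ContinuousLinearMap.inl ℝ B (Fin q → ℝ)) (fibreVec B q)
    (A (b, t))

lemma contDiffOn_fibreIntegral {p : ℕ} (h : p ≤ n) (hT : IsOpen T) (hU : IsOpen U)
    (hsub : cornerSimplex q ⊆ U) (hA : ContDiffOn ℝ ∞ A (T ×ˢ U)) :
    ContDiffOn ℝ ∞ (fibreIntegral h A) T :=
  contDiffOn_integral (F := fun z => spliceHead h (ContinuousLinearMap.inl ℝ B (Fin q → ℝ))
    (fibreVec B q) (A z)) hT hU (isCompact_cornerSimplex q) hsub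
    ((ContinuousLinearMap.contDiff _).comp_contDiffOn hA)

/-- The fibre integral takes values in alternating maps, so that smoothness is inherited from
`contDiffOn_integral`; evaluation at `Y` is continuous and linear and passes through the integral.
-/
lemma fibreIntegral_apply {p : ℕ} (h : p ≤ n) (hsub : cornerSimplex q ⊆ U)
    (hA : ContinuousOn A (T ×ˢ U)) {b : B} (hb : b ∈ T) (Y : Fin p → B) :
    fibreIntegral h A b Y = ∫ t in cornerSimplex q,
      A (b, t) (splice n p (fun k => (extendZero Y k, 0)) (fibreVec B q)) := by
  have hint := integrableOn_slice (μ := volume) (F := fun z => spliceHead h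
    (ContinuousLinearMap.inl ℝ B (Fin q → ℝ)) (fibreVec B q) (A z)) (isCompact_cornerSimplex q)
    hsub ((ContinuousLinearMap.continuous _).comp_continuousOn hA) hb
  exact ((ContinuousAlternatingMap.apply ℝ B ℝ Y).integral_comp_comm hint).symm

lemma continuousOn_fderiv_apply (hT : IsOpen T) (hU : IsOpen U)
    (hA : ContDiffOn ℝ ∞ A (T ×ˢ U)) (w : B × (Fin q → ℝ)) (v : Fin n → B × (Fin q → ℝ)) :
    ContinuousOn (fun z => fderiv ℝ A z w v) (T ×ˢ U) :=
  (ContinuousAlternatingMap.apply ℝ _ ℝ v).continuous.comp_continuousOn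
    ((hA.continuousOn_fderiv_of_isOpen (hT.prod hU) (by simp)).clm_apply continuousOn_const)

lemma integrableOn_fderiv_apply (hT : IsOpen T) (hU : IsOpen U) (hsub : cornerSimplex q ⊆ U)
    (hA : ContDiffOn ℝ ∞ A (T ×ˢ U)) {b : B} (hb : b ∈ T) (w : B × (Fin q → ℝ))
    (v : Fin n → B × (Fin q → ℝ)) :
    IntegrableOn (fun t => fderiv ℝ A (b, t) w v) (cornerSimplex q) :=
  integrableOn_slice (F := fun z => fderiv ℝ A z w v) (isCompact_cornerSimplex q)
    hsub (continuousOn_fderiv_apply hT hU hA w v) hb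

/-- Differentiation under the integral sign: only derivatives in base directions appear. -/
lemma extDeriv_fibreIntegral {p : ℕ} (h : p ≤ n) (hT : IsOpen T) (hU : IsOpen U)
    (hsub : cornerSimplex q ⊆ U) (hA : ContDiffOn ℝ ∞ A (T ×ˢ U)) {b : B} (hb : b ∈ T)
    (Y : Fin (p + 1) → B) :
    extDeriv (fibreIntegral h A) b Y = ∑ i ∈ Finset.range (p + 1), (-1 : ℝ) ^ i *
      ∫ t in cornerSimplex q, fderiv ℝ A (b, t) (extendZero Y i, 0)
        (splice n p (skip i fun k => (extendZero Y k, 0)) (fibreVec B q)) := by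
  let C := spliceHead h (ContinuousLinearMap.inl ℝ B (Fin q → ℝ)) (fibreVec B q)
  have hC : ContDiffOn ℝ ∞ (fun z => C (A z)) (T ×ˢ U) :=
    (ContinuousLinearMap.contDiff _).comp_contDiffOn hA
  have hf : fderiv ℝ (fibreIntegral h A) b = _ :=
    (hasFDerivAt_integral_of_contDiffOn (μ := volume) hT hU (isCompact_cornerSimplex q) hsub
      (hC.of_le (by simp)) hb).fderiv
  -- An empty second block brings `Y` into the shape required by `alternatizeUncurryFin_splice`.
  have hY : Y = splice (p + 1) (p + 1) (extendZero Y) 0 := by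
    funext i
    simp only [splice, if_pos i.isLt, extendZero_val]
  unfold extDeriv
  conv_lhs => rw [hY]
  rw [alternatizeUncurryFin_splice (q := 0) rfl, Finset.range_zero, Finset.sum_empty, mul_zero,
    add_zero]
  refine Finset.sum_congr rfl fun i _ => ?_
  congr 1
  have hint := integrableOn_slice (μ := volume) (F := fun z => (fderiv ℝ (fun z => C (A z)) z).comp
    (ContinuousLinearMap.inl ℝ B (Fin q → ℝ))) (isCompact_cornerSimplex q)
    hsub ((hC.continuousOn_fderiv_of_isOpen (hT.prod hU) (by simp)).clm_comp continuousOn_const) hb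
  rw [hf, ContinuousLinearMap.integral_apply hint]
  have e := ((ContinuousAlternatingMap.apply ℝ B ℝ
    (splice p p (skip i (extendZero Y)) 0)).integral_comp_comm
      (hint.apply_continuousLinearMap (extendZero Y i))).symm
  refine e.trans ?_
  refine setIntegral_congr_fun (measurableSet_cornerSimplex q) fun t ht => ?_
  have hd : DifferentiableAt ℝ A (b, t) :=
    (hA.contDiffAt ((hT.prod hU).mem_nhds ⟨hb, hsub ht⟩)).differentiableAt (by simp)
  have hfd : fderiv ℝ (fun z => C (A z)) (b, t) = C.comp (fderiv ℝ A (b, t)) :=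
    (C.hasFDerivAt.comp (b, t) hd.hasFDerivAt).fderiv
  change (fderiv ℝ (fun z => C (A z)) (b, t)) (extendZero Y i, 0) _ = _
  rw [hfd]
  change spliceHead h _ _ _ _ = _
  rw [spliceHead_apply]
  congr 1
  refine splice_congr (q := n) (by omega) (fun k hk => ?_) fun _ _ => rfl
  have hk' : extendZero (splice p p (skip i (extendZero Y)) 0) k = skip i (extendZero Y) k := by
    simp [extendZero, splice, hk]
  rw [hk']
  simp only [skip]
  split_ifs <;> rfl

/-- The integral of the exterior derivative along the fibre. -/
noncomputable def fibreDerivIntegral (p : ℕ)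
    (A : B × (Fin q → ℝ) → (B × (Fin q → ℝ)) [⋀^Fin n]→L[ℝ] ℝ) (Y : ℕ → B × (Fin q → ℝ))
    (b : B) : ℝ :=
  ∫ t in cornerSimplex q, ∑ k ∈ Finset.range q, (-1 : ℝ) ^ k *
    fderiv ℝ A (b, t) (fibreVec B q k) (splice n p Y (skip k (fibreVec B q)))

/-- The splitting into base and fibre derivatives, integrated termwise. The case `p = 0` is
included, as it gives Stokes' theorem with no base vectors. -/
lemma integral_extDeriv_splice {p : ℕ} (h : n + 1 = p + q) (hT : IsOpen T) (hU : IsOpen U)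
    (hsub : cornerSimplex q ⊆ U) (hA : ContDiffOn ℝ ∞ A (T ×ˢ U)) {b : B} (hb : b ∈ T)
    (Y : ℕ → B × (Fin q → ℝ)) :
    ∫ t in cornerSimplex q, extDeriv A (b, t) (splice (n + 1) p Y (fibreVec B q)) =
      (∑ i ∈ Finset.range p, (-1 : ℝ) ^ i * ∫ t in cornerSimplex q, fderiv ℝ A (b, t) (Y i)
          (splice n (p - 1) (skip i Y) (fibreVec B q))) +
        (-1 : ℝ) ^ p * fibreDerivIntegral p A Y b := by
  have hi := fun w v => integrableOn_fderiv_apply hT hU hsub hA hb w v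
  simp only [extDeriv, alternatizeUncurryFin_splice h]
  rw [integral_add, integral_const_mul, integral_finsetSum _ fun i _ => (hi _ _).const_mul _]
  · simp only [integral_const_mul, fibreDerivIntegral]
  · exact integrable_finsetSum _ fun i _ => (hi _ _).const_mul _
  · exact (integrable_finsetSum _ fun i _ => (hi _ _).const_mul _).const_mul _

/-- Exterior differentiation commutes with fibre integration up to a boundary term. -/
lemma integral_extDeriv_succ {p : ℕ} (h : n = p + q) (hT : IsOpen T) (hU : IsOpen U)
    (hsub : cornerSimplex q ⊆ U) (hA : ContDiffOn ℝ ∞ A (T ×ˢ U)) {b : B} (hb : b ∈ T)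
    (Y : Fin (p + 1) → B) :
    ∫ t in cornerSimplex q, extDeriv A (b, t)
        (splice (n + 1) (p + 1) (fun k => (extendZero Y k, 0)) (fibreVec B q)) =
      extDeriv (fibreIntegral (by omega : p ≤ n) A) b Y +
        (-1 : ℝ) ^ (p + 1) * fibreDerivIntegral (p + 1) A (fun k => (extendZero Y k, 0)) b := by
  rw [integral_extDeriv_splice (by omega) hT hU hsub hA hb,
    extDeriv_fibreIntegral _ hT hU hsub hA hb]
  rfl

lemma fibreDerivIntegral_zero (p : ℕ) (A : B × (Fin 0 → ℝ) → (B × (Fin 0 → ℝ)) [⋀^Fin n]→L[ℝ] ℝ)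
    (Y : ℕ → B × (Fin 0 → ℝ)) (b : B) : fibreDerivIntegral p A Y b = 0 := by
  simp [fibreDerivIntegral]

/-- Stokes' theorem in the fibres. -/
lemma fibreDerivIntegral_succ {p : ℕ} (h : n = p + q) {U : Set (Fin (q + 1) → ℝ)}
    {A : B × (Fin (q + 1) → ℝ) → (B × (Fin (q + 1) → ℝ)) [⋀^Fin n]→L[ℝ] ℝ}
    (hT : IsOpen T) (hU : IsOpen U) (hsub : cornerSimplex (q + 1) ⊆ U)
    (hA : ContDiffOn ℝ ∞ A (T ×ˢ U)) {b : B} (hb : b ∈ T) (Y : ℕ → B × (Fin (q + 1) → ℝ)) :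
    fibreDerivIntegral p A Y b = ∑ j : Fin (q + 2), (-1 : ℝ) ^ (j : ℕ) *
      ∫ s in cornerSimplex q, A (b, faceMap j s)
        (splice n p Y fun k => (0, faceLin j (stdVec q k))) := by
  -- With `b` and `Y` fixed, these are the coefficients of a `q`-form on the fibre, the `i`-th basis
  -- vector being omitted.
  let β : Fin (q + 1) → (Fin (q + 1) → ℝ) → ℝ := fun i t =>
    A (b, t) (splice n p Y (skip i (fibreVec B (q + 1))))
  have hβ : ∀ i, ContDiffOn ℝ 1 (β i) U := fun i =>
    (ContinuousAlternatingMap.apply ℝ (B × (Fin (q + 1) → ℝ)) ℝ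
      (splice n p Y (skip i (fibreVec B (q + 1))))).contDiff.comp_contDiffOn
      ((hA.of_le (by simp)).comp (by fun_prop) fun t ht => ⟨hb, ht⟩)
  have hfd : ∀ t ∈ U, ∀ i : Fin (q + 1), fderiv ℝ (β i) t (Pi.single i 1) =
      fderiv ℝ A (b, t) (fibreVec B (q + 1) i)
        (splice n p Y (skip i (fibreVec B (q + 1)))) := fun t ht i => by
    have hd : DifferentiableAt ℝ A (b, t) :=
      (hA.contDiffAt ((hT.prod hU).mem_nhds ⟨hb, ht⟩)).differentiableAt (by simp)
    have h1 := (ContinuousAlternatingMap.apply ℝ (B × (Fin (q + 1) → ℝ)) ℝ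
      (splice n p Y (skip i (fibreVec B (q + 1))))).hasFDerivAt.comp t
      (hd.hasFDerivAt.comp t (hasFDerivAt_prodMk_right b t))
    rw [show fderiv ℝ (β i) t = _ from h1.fderiv, fibreVec, stdVec_val]
    rfl
  have h1 := integral_divergence_cornerSimplex hU hsub hβ
  rw [Fin.sum_univ_succ]
  refine Eq.trans ?_ (h1.trans ?_)
  · refine setIntegral_congr_fun (measurableSet_cornerSimplex _) fun t ht => ?_
    rw [Finset.sum_range]
    exact Finset.sum_congr rfl fun i _ => by rw [hfd t (hsub ht) i]
  · congr 1
    · rw [Fin.val_zero, pow_zero, one_mul]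
      refine setIntegral_congr_fun (measurableSet_cornerSimplex _) fun s _ => ?_
      -- On the slanted face the alternating sum of all coefficients is the form evaluated on the
      -- edges issuing from one vertex.
      have h2 := map_splice_sub h (A (b, faceMap 0 s)) Y (fibreVec B (q + 1))
      rw [Finset.sum_range, faceMap_zero] at h2
      simp only [faceMap_zero]
      refine h2.symm.trans ?_
      congr 1
      refine splice_congr h.le (fun _ _ => rfl) fun k hk => ?_
      rw [faceLin_zero_stdVec hk]
      simp [fibreVec]
    · refine Finset.sum_congr rfl fun i _ => ?_
      rw [Fin.val_succ]
      congr 1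
      refine setIntegral_congr_fun (measurableSet_cornerSimplex _) fun s _ => ?_
      simp only [β, faceMap_succ]
      congr 1
      refine splice_congr h.le (fun _ _ => rfl) fun k hk => ?_
      rw [faceLin_succ_stdVec]
      simp only [skip, fibreVec]
      split_ifs <;> rfl

end Fibre

/-! ### Pullbacks of forms to open subsets of vector spaces -/

section LocalPullback

variable {X : Type*} [NormedAddCommGroup X] [NormedSpace ℝ X]
  {E M : Type*} [NormedAddCommGroup E] [NormedSpace ℝ E] [TopologicalSpace M]
  [ChartedSpace E M] [IsManifold 𝓘(ℝ, E) ∞ M] {k : ℕ} {O : Set X} {f : X → M}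

/-- The pullback of a form to a vector space, as a function on this space. -/
noncomputable def localRep {X : Type*} [NormedAddCommGroup X] [NormedSpace ℝ X]
    {E M : Type*} [NormedAddCommGroup E] [NormedSpace ℝ E] [TopologicalSpace M]
    [ChartedSpace E M] {k : ℕ} (f : X → M) (η : RawForm E M k) : X → X [⋀^Fin k]→L[ℝ] ℝ :=
  pullback (E := X) f η

/-- Near `y₀`, `f` is the inverse chart at `f y₀` composed with a smooth map `u` of vector spaces,
so the pullback by `f` is the pullback by `u` of the chart expression. -/
lemma localRep_eventuallyEq_chartRep (hO : IsOpen O) (hf : ContMDiffOn 𝓘(ℝ, X) 𝓘(ℝ, E) ∞ f O)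
    (η : RawForm E M k) {y₀ : X} (hy₀ : y₀ ∈ O) :
    ContDiffAt ℝ ∞ (extChartAt 𝓘(ℝ, E) (f y₀) ∘ f) y₀ ∧
      localRep f η =ᶠ[𝓝 y₀] fun y =>
        (chartRep η (f y₀) (extChartAt 𝓘(ℝ, E) (f y₀) (f y))).compContinuousLinearMap
          (fderiv ℝ (extChartAt 𝓘(ℝ, E) (f y₀) ∘ f) y) := by
  set z := f y₀ with hz
  set u := extChartAt 𝓘(ℝ, E) z ∘ f with hu_def
  have hfa : ∀ y ∈ O, ContMDiffAt 𝓘(ℝ, X) 𝓘(ℝ, E) ∞ f y := fun y hy =>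
    hf.contMDiffAt (hO.mem_nhds hy)
  have hev : ∀ᶠ y in 𝓝 y₀, y ∈ O ∧ f y ∈ (extChartAt 𝓘(ℝ, E) z).source :=
    Filter.Eventually.and (hO.mem_nhds hy₀) ((hfa y₀ hy₀).continuousAt.preimage_mem_nhds
      (extChartAt_source_mem_nhds (I := 𝓘(ℝ, E)) z))
  have hu : ∀ y, (y ∈ O ∧ f y ∈ (extChartAt 𝓘(ℝ, E) z).source) →
      ContMDiffAt 𝓘(ℝ, X) 𝓘(ℝ, E) ∞ u y := fun y hy =>
    (contMDiffAt_extChartAt' (by simpa using hy.2)).comp y (hfa y hy.1)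
  refine ⟨(hu y₀ hev.self_of_nhds).contDiffAt, ?_⟩
  filter_upwards [hev, hev.eventually_nhds] with y hy hy'
  have h2 : f =ᶠ[𝓝 y] (extChartAt 𝓘(ℝ, E) z).symm ∘ u := by
    filter_upwards [hy'] with w hw
    exact ((extChartAt 𝓘(ℝ, E) z).left_inv hw.2).symm
  have hut : u y ∈ (extChartAt 𝓘(ℝ, E) z).target := (extChartAt 𝓘(ℝ, E) z).map_source hy.2
  have h3 : MDifferentiableAt 𝓘(ℝ, E) 𝓘(ℝ, E) (extChartAt 𝓘(ℝ, E) z).symm (u y) :=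
    ((contMDiffOn_extChartAt_symm (n := ∞) z).contMDiffAt
      ((isOpen_extChartAt_target z).mem_nhds hut)).mdifferentiableAt (by simp)
  change pullback (E := X) f η y = _
  rw [pullback_congr η h2,
    ← pullback_pullback_apply (E := E) (M := E) η h3 ((hu y hy).mdifferentiableAt (by simp))]
  simp only [pullback, chartRep, mfderiv_eq_fderiv]
  rfl

/-- The pullback of a smooth form under a smooth map defined on an open subset of a vector
space is smooth. -/
lemma contDiffOn_localRep (hO : IsOpen O) (hf : ContMDiffOn 𝓘(ℝ, X) 𝓘(ℝ, E) ∞ f O)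
    {η : RawForm E M k} (hη : IsSmoothForm η) :
    ContDiffOn ℝ ∞ (localRep f η) O := by
  intro y hy
  obtain ⟨hu, he⟩ := localRep_eventuallyEq_chartRep hO hf η hy
  refine ContDiffAt.contDiffWithinAt (ContDiffAt.congr_of_eventuallyEq ?_ he)
  refine contDiffAt_compContinuousLinearMap ?_ (hu.fderiv_right (by simp))
  exact ContDiffAt.comp y ((hη (f y)).contDiffAt ((isOpen_extChartAt_target (f y)).mem_nhds
    (mem_extChartAt_target (f y)))) hu

/-- The exterior derivative commutes with pullbacks to open subsets of vector spaces. -/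
lemma extDeriv_localRep (hO : IsOpen O) (hf : ContMDiffOn 𝓘(ℝ, X) 𝓘(ℝ, E) ∞ f O)
    {η : RawForm E M k} (hη : IsSmoothForm η) {y : X} (hy : y ∈ O) :
    extDeriv (localRep f η) y = localRep f (extDerivRaw η) y := by
  obtain ⟨hu, he⟩ := localRep_eventuallyEq_chartRep hO hf η hy
  have hd : DifferentiableAt ℝ (chartRep η (f y)) ((extChartAt 𝓘(ℝ, E) (f y) ∘ f) y) :=
    ((hη (f y)).contDiffAt ((isOpen_extChartAt_target (f y)).mem_nhds
      (mem_extChartAt_target (f y)))).differentiableAt (by simp)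
  have h := extDeriv_pullback hd hu (by
    simpa using (WithTop.coe_le_coe.2 (le_top : (2 : ℕ∞) ≤ ⊤)))
  rw [Filter.EventuallyEq.extDeriv_eq he]
  refine h.trans ?_
  have hc : MDifferentiableAt 𝓘(ℝ, E) 𝓘(ℝ, E) (extChartAt 𝓘(ℝ, E) (f y)) (f y) :=
    (contMDiffAt_extChartAt (n := ∞) (x := f y)).mdifferentiableAt (by simp)
  have hfy : MDifferentiableAt 𝓘(ℝ, X) 𝓘(ℝ, E) f y :=
    (hf.contMDiffAt (hO.mem_nhds hy)).mdifferentiableAt (by simp)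
  have : fderiv ℝ (extChartAt 𝓘(ℝ, E) (f y) ∘ f) y =
      (mfderiv 𝓘(ℝ, E) 𝓘(ℝ, E) (extChartAt 𝓘(ℝ, E) (f y)) (f y)).comp
        (mfderiv 𝓘(ℝ, X) 𝓘(ℝ, E) f y) := by
    rw [← mfderiv_eq_fderiv]
    exact mfderiv_comp y hc hfy
  rw [this]
  rfl

end LocalPullback

/-! ### Parametrizations of smooth simplices -/

section Simplex

variable {E M : Type*} [NormedAddCommGroup E] [NormedSpace ℝ E] [TopologicalSpace M]
  [ChartedSpace E M] {q : ℕ}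

lemma contDiff_bary : ContDiff ℝ ∞ (bary : (Fin q → ℝ) → _) := by
  refine contDiff_pi.2 fun i => ?_
  refine Fin.cases ?_ (fun k => ?_) i
  · simp only [bary, Fin.cons_zero]
    fun_prop
  · simp only [bary, Fin.cons_succ]
    fun_prop

lemma bary_tail {v : Fin (q + 1) → ℝ} (hv : ∑ i, v i = 1) : bary (Fin.tail v) = v := by
  rw [Fin.sum_univ_succ] at hv
  funext i
  refine Fin.cases ?_ (fun k => ?_) i
  · simp only [bary, Fin.cons_zero, Fin.tail]
    linarith
  · simp [bary, Fin.tail]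

lemma bary_faceMap (j : Fin (q + 2)) (s : Fin q → ℝ) :
    bary (faceMap j s) = (j.insertNth (0 : ℝ) (bary s) : Fin (q + 2) → ℝ) := by
  refine bary_tail ?_
  rw [Fin.sum_univ_succAbove _ j]
  simp [bary, Fin.sum_univ_succ]

lemma SmoothSimplex.param_of_mem (σ : SmoothSimplex E M q) {t : Fin q → ℝ}
    (ht : t ∈ cornerSimplex q) : σ.param t = σ.toFun ⟨bary t, bary_mem ht⟩ := by
  simp [SmoothSimplex.param, ht]

/-- In barycentric coordinates both face maps insert a zero at position `j`. -/
lemma SmoothSimplex.param_face (σ : SmoothSimplex E M (q + 1)) (j : Fin (q + 2)) {s : Fin q → ℝ}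
    (hs : s ∈ cornerSimplex q) : (σ.face j).param s = σ.param (faceMap j s) := by
  rw [SmoothSimplex.param_of_mem _ hs, SmoothSimplex.param_of_mem _ (faceMap_mem j hs)]
  change σ.toFun _ = _
  congr 1
  ext i
  change FunOnFinite.linearMap ℝ ℝ j.succAbove (bary s) i = bary (faceMap j s) i
  rw [bary_faceMap]
  revert i
  refine (Fin.forall_iff_succAbove j).2 ⟨?_, fun i => ?_⟩
  · simp [FunOnFinite.linearMap_apply_apply]
  · simp [FunOnFinite.linearMap_apply_apply, Finset.sum_filter]

/-- A smooth simplex is the restriction of a smooth map on an open neighbourhood of the corner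
simplex. -/
lemma SmoothSimplex.exists_extension (σ : SmoothSimplex E M q) :
    ∃ (U : Set (Fin q → ℝ)) (τ : (Fin q → ℝ) → M), IsOpen U ∧ cornerSimplex q ⊆ U ∧
      ContMDiffOn 𝓘(ℝ, Fin q → ℝ) 𝓘(ℝ, E) ∞ τ U ∧ Set.EqOn σ.param τ (cornerSimplex q) := by
  obtain ⟨U, f, hU, hsub, hf, he⟩ := σ.smooth'
  refine ⟨bary ⁻¹' U, f ∘ bary, hU.preimage contDiff_bary.continuous,
    fun t ht => hsub (bary_mem ht), ?_, fun t ht => ?_⟩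
  · exact hf.comp contDiff_bary.contMDiff.contMDiffOn fun _ h => h
  · rw [SmoothSimplex.param_of_mem _ ht]
    exact he _

/-- By unique differentiability, the values on the simplex alone determine the derivative, even at
boundary points; hence it can be computed from a smooth extension. -/
lemma mfderivWithin_cornerSimplex {τ ρ : (Fin q → ℝ) → M}
    (h : Set.EqOn ρ τ (cornerSimplex q)) {t : Fin q → ℝ} (ht : t ∈ cornerSimplex q)
    (hτ : MDifferentiableAt 𝓘(ℝ, Fin q → ℝ) 𝓘(ℝ, E) τ t) :
    (mfderivWithin 𝓘(ℝ, Fin q → ℝ) 𝓘(ℝ, E) ρ (cornerSimplex q) t : (Fin q → ℝ) →L[ℝ] E) =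
      mfderiv 𝓘(ℝ, Fin q → ℝ) 𝓘(ℝ, E) τ t := by
  rw [mfderivWithin_congr h (h ht)]
  exact mfderivWithin_eq_mfderiv
    ((uniqueMDiffWithinAt_iff_uniqueDiffWithinAt).2 (uniqueDiffOn_cornerSimplex q t ht)) hτ

end Simplex

/-! ### The orbit map of a parametrized simplex -/

section Orbit

lemma mdifferentiableAt_extChartAt_symm {B G : Type*} [NormedAddCommGroup B] [NormedSpace ℝ B]
    [TopologicalSpace G] [ChartedSpace B G] [IsManifold 𝓘(ℝ, B) ∞ G] (g : G) {b : B}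
    (hb : b ∈ (extChartAt 𝓘(ℝ, B) g).target) :
    MDifferentiableAt 𝓘(ℝ, B) 𝓘(ℝ, B) (extChartAt 𝓘(ℝ, B) g).symm b :=
  ((contMDiffOn_extChartAt_symm (n := ∞) g).contMDiffAt
    ((isOpen_extChartAt_target g).mem_nhds hb)).mdifferentiableAt (by simp)

variable {B G : Type*} [NormedAddCommGroup B] [NormedSpace ℝ B] [TopologicalSpace G]
  [ChartedSpace B G] [Group G]
variable {E M : Type*} [NormedAddCommGroup E] [NormedSpace ℝ E] [TopologicalSpace M]
  [ChartedSpace E M] [MulAction G M]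
variable {V : Type*} [NormedAddCommGroup V] [NormedSpace ℝ V]

variable (B) in
/-- The map `(b, t) ↦ ψ⁻¹(b) • τ(t)`, where `ψ` is the preferred chart of `G` at `g`. -/
noncomputable def orbitMap (g : G) (τ : V → M) : B × V → M :=
  fun z => (extChartAt 𝓘(ℝ, B) g).symm z.1 • τ z.2

lemma contMDiff_smul_left [ContMDiffSMul 𝓘(ℝ, B) 𝓘(ℝ, E) ∞ G M] (x : M) :
    ContMDiff 𝓘(ℝ, B) 𝓘(ℝ, E) ∞ (fun h : G => h • x) :=
  (contMDiff_smul (I := 𝓘(ℝ, B)) (I' := 𝓘(ℝ, E)) (n := ∞) (G := G) (M := M)).comp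
    (contMDiff_id.prodMk contMDiff_const)

variable [IsManifold 𝓘(ℝ, B) ∞ G] [ContMDiffSMul 𝓘(ℝ, B) 𝓘(ℝ, E) ∞ G M]

lemma contMDiffOn_orbitMap (g : G) {τ : V → M} {U : Set V}
    (hτ : ContMDiffOn 𝓘(ℝ, V) 𝓘(ℝ, E) ∞ τ U) :
    ContMDiffOn 𝓘(ℝ, B × V) 𝓘(ℝ, E) ∞ (orbitMap B g τ)
      ((extChartAt 𝓘(ℝ, B) g).target ×ˢ U) := by
  have h1 : ContMDiffOn 𝓘(ℝ, B × V) 𝓘(ℝ, B) ∞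
      (fun z : B × V => (extChartAt 𝓘(ℝ, B) g).symm z.1)
      ((extChartAt 𝓘(ℝ, B) g).target ×ˢ U) :=
    (contMDiffOn_extChartAt_symm g).comp contDiff_fst.contMDiff.contMDiffOn fun z hz => hz.1
  have h2 : ContMDiffOn 𝓘(ℝ, B × V) 𝓘(ℝ, E) ∞ (fun z : B × V => τ z.2)
      ((extChartAt 𝓘(ℝ, B) g).target ×ˢ U) :=
    hτ.comp contDiff_snd.contMDiff.contMDiffOn fun z hz => hz.2
  exact (contMDiff_smul (I := 𝓘(ℝ, B)) (I' := 𝓘(ℝ, E)) (n := ∞) (G := G) (M := M)).comp_contMDiffOn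
    (h1.prodMk h2)

/-- With `t` fixed, the orbit map is the inverse chart followed by the orbit of `τ t`. -/
lemma mfderiv_orbitMap_left (g : G) {τ : V → M} {U : Set V} (hU : IsOpen U)
    (hτ : ContMDiffOn 𝓘(ℝ, V) 𝓘(ℝ, E) ∞ τ U) {b : B} (hb : b ∈ (extChartAt 𝓘(ℝ, B) g).target)
    {t : V} (ht : t ∈ U) (Y : B) :
    (mfderiv 𝓘(ℝ, B × V) 𝓘(ℝ, E) (orbitMap B g τ) (b, t) (Y, (0 : V)) : E) =
      mfderiv 𝓘(ℝ, B) 𝓘(ℝ, E) (fun h : G => h • τ t) ((extChartAt 𝓘(ℝ, B) g).symm b)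
        (mfderiv 𝓘(ℝ, B) 𝓘(ℝ, B) (extChartAt 𝓘(ℝ, B) g).symm b Y) := by
  have hΨ : MDifferentiableAt 𝓘(ℝ, B × V) 𝓘(ℝ, E) (orbitMap B g τ) (b, t) :=
    ((contMDiffOn_orbitMap g hτ).contMDiffAt
      (((isOpen_extChartAt_target g).prod hU).mem_nhds ⟨hb, ht⟩)).mdifferentiableAt (by simp)
  have hi : HasFDerivAt (fun b : B => (b, t)) (ContinuousLinearMap.inl ℝ B V) b :=
    hasFDerivAt_prodMk_left b t
  have h1 := mfderiv_comp b hΨ hi.differentiableAt.mdifferentiableAt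
  have h2 := mfderiv_comp b ((contMDiff_smul_left (B := B) (E := E) (G := G) (τ t)).mdifferentiableAt (by simp))
    (mdifferentiableAt_extChartAt_symm g hb)
  rw [mfderiv_eq_fderiv, hi.fderiv] at h1
  exact DFunLike.congr_fun (h1.symm.trans h2) Y

lemma mfderiv_orbitMap_right (g : G) {τ : V → M} {U : Set V} (hU : IsOpen U)
    (hτ : ContMDiffOn 𝓘(ℝ, V) 𝓘(ℝ, E) ∞ τ U) {b : B} (hb : b ∈ (extChartAt 𝓘(ℝ, B) g).target)
    {t : V} (ht : t ∈ U) (v : V) :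
    (mfderiv 𝓘(ℝ, B × V) 𝓘(ℝ, E) (orbitMap B g τ) (b, t) ((0 : B), v) : E) =
      mfderiv 𝓘(ℝ, E) 𝓘(ℝ, E) (fun x : M => (extChartAt 𝓘(ℝ, B) g).symm b • x) (τ t)
        (mfderiv 𝓘(ℝ, V) 𝓘(ℝ, E) τ t v) := by
  have hΨ : MDifferentiableAt 𝓘(ℝ, B × V) 𝓘(ℝ, E) (orbitMap B g τ) (b, t) :=
    ((contMDiffOn_orbitMap g hτ).contMDiffAt
      (((isOpen_extChartAt_target g).prod hU).mem_nhds ⟨hb, ht⟩)).mdifferentiableAt (by simp)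
  have hi : HasFDerivAt (fun t : V => (b, t)) (ContinuousLinearMap.inr ℝ B V) t :=
    hasFDerivAt_prodMk_right b t
  have h1 := mfderiv_comp t hΨ hi.differentiableAt.mdifferentiableAt
  have h2 := mfderiv_comp t
    ((contMDiff_action B ((extChartAt 𝓘(ℝ, B) g).symm b)).mdifferentiableAt (by simp))
    ((hτ.contMDiffAt (hU.mem_nhds ht)).mdifferentiableAt (by simp))
  rw [mfderiv_eq_fderiv, hi.fderiv] at h1
  exact DFunLike.congr_fun (h1.symm.trans h2) v

end Orbit

/-! ### Integration over the orbits of a smooth chain -/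

section OrbitIntegral

/-- All tangent spaces are by definition the model space, so vectors at equal but not syntactically
identical points can be compared there, without rewriting in dependent types. -/
lemma rawForm_congr {E M : Type*} [NormedAddCommGroup E] [NormedSpace ℝ E] [TopologicalSpace M]
    [ChartedSpace E M] {n : ℕ} (η : RawForm E M n) {x y : M} (h : x = y) {v w : Fin n → E}
    (hvw : v = w) : η x v = η y w := by
  subst h hvw
  rfl

lemma extendZero_comp {W W' : Type*} [Zero W] [Zero W'] (f : W → W') (h0 : f 0 = 0) {p : ℕ}
    (Y : Fin p → W) : extendZero (fun i => f (Y i)) = fun k => f (extendZero Y k) := by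
  funext k
  simp only [extendZero]
  split_ifs
  · rfl
  · exact h0.symm

/-- The derivative at `b` of the inverse of the preferred chart at `g`. -/
noncomputable def symmDeriv {B G : Type*} [NormedAddCommGroup B] [NormedSpace ℝ B]
    [TopologicalSpace G] [ChartedSpace B G] (g : G) (b : B) : B →L[ℝ] B :=
  mfderiv 𝓘(ℝ, B) 𝓘(ℝ, B) (extChartAt 𝓘(ℝ, B) g).symm b

/-- The chain rule for the chart followed by its inverse. It lets any tangent vector at `g` be
reached from its coordinates, so that chart formulas apply to arbitrary vectors. -/
lemma symmDeriv_extChartAt_apply {B G : Type*} [NormedAddCommGroup B] [NormedSpace ℝ B]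
    [TopologicalSpace G] [ChartedSpace B G] [IsManifold 𝓘(ℝ, B) ∞ G] (g : G) (Y : B) :
    symmDeriv g (extChartAt 𝓘(ℝ, B) g g)
      (mfderiv 𝓘(ℝ, B) 𝓘(ℝ, B) (extChartAt 𝓘(ℝ, B) g) g Y) = Y := by
  have h1 : MDifferentiableAt 𝓘(ℝ, B) 𝓘(ℝ, B) (extChartAt 𝓘(ℝ, B) g) g :=
    (contMDiffAt_extChartAt (n := ∞) (x := g)).mdifferentiableAt (by simp)
  have h2 := mdifferentiableAt_extChartAt_symm g (mem_extChartAt_target (I := 𝓘(ℝ, B)) g)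
  have h3 := mfderiv_comp g h2 h1
  have h4 : (extChartAt 𝓘(ℝ, B) g).symm ∘ extChartAt 𝓘(ℝ, B) g =ᶠ[𝓝 g] id := by
    filter_upwards [extChartAt_source_mem_nhds (I := 𝓘(ℝ, B)) g] with x hx
    exact (extChartAt 𝓘(ℝ, B) g).left_inv hx
  rw [h4.mfderiv_eq, mfderiv_id] at h3
  exact (DFunLike.congr_fun h3 Y).symm

variable {B G : Type*} [NormedAddCommGroup B] [NormedSpace ℝ B] [TopologicalSpace G]
  [ChartedSpace B G] [Group G]
variable {E M : Type*} [NormedAddCommGroup E] [NormedSpace ℝ E] [TopologicalSpace M]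
  [ChartedSpace E M] [MulAction G M] {q n : ℕ}

/-- The value of a form at `g • σ(t)` on the images of `Y 0, …, Y (p - 1)` under the derivative of
the orbit map at `g` followed by the images of the coordinate vectors under the derivative of
`g • σ`. -/
noncomputable def SmoothSimplex.orbitIntegrand (σ : SmoothSimplex E M q) (η : RawForm E M n) (p : ℕ)
    (g : G) (Y : ℕ → B) (t : Fin q → ℝ) : ℝ :=
  η (g • σ.param t) (splice n p
    (fun k => (mfderiv 𝓘(ℝ, B) 𝓘(ℝ, E) (fun h : G => h • σ.param t) g (Y k) : E))
    (fun k => (mfderiv 𝓘(ℝ, E) 𝓘(ℝ, E) (fun x : M => g • x) (σ.param t)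
      (mfderivWithin 𝓘(ℝ, Fin q → ℝ) 𝓘(ℝ, E) σ.param (cornerSimplex q) t (stdVec q k)) : E)))

/-- The integral of a form over `g • σ`, after inserting `p` vectors tangent to the orbits. -/
noncomputable def SmoothSimplex.orbitIntegral (σ : SmoothSimplex E M q) (η : RawForm E M n) (p : ℕ)
    (g : G) (Y : ℕ → B) : ℝ :=
  ∫ t in cornerSimplex q, σ.orbitIntegrand η p g Y t

/-- The integral of a form over `g • γ`, after inserting `p` vectors tangent to the orbits. -/
noncomputable def orbitIntegral (γ : SmoothChain E M q) (η : RawForm E M n) (p : ℕ) (g : G)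
    (Y : ℕ → B) : ℝ :=
  γ.sum fun σ a => a * σ.orbitIntegral η p g Y

lemma orbitIntegral_eq_linearCombination (γ : SmoothChain E M q) (η : RawForm E M n) (p : ℕ) (g : G)
    (Y : ℕ → B) : orbitIntegral γ η p g Y =
      Finsupp.linearCombination ℝ (fun σ : SmoothSimplex E M q => σ.orbitIntegral η p g Y) γ := rfl

/-- The alternating sum of the orbit integrals over the faces of a simplex. -/
noncomputable def SmoothSimplex.faceIntegral : {q : ℕ} → SmoothSimplex E M q → RawForm E M n → ℕ →
    G → (ℕ → B) → ℝ
  | 0, _, _, _, _, _ => 0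
  | q + 1, σ, η, p, g, Y =>
      ∑ j : Fin (q + 2), (-1 : ℝ) ^ (j : ℕ) * (σ.face j).orbitIntegral η p g Y

/-- The orbit integral is linear in the chain, so the sum is the orbit integral over `∂γ`. In
dimension `0` the face integral is zero by definition, in accordance with every `0`-chain being a
cycle. -/
lemma sum_faceIntegral_eq_zero {q : ℕ} {γ : SmoothChain E M q} (hγ : IsCycle γ) (η : RawForm E M n)
    (p : ℕ) (g : G) (Y : ℕ → B) : (γ.sum fun σ a => a * σ.faceIntegral η p g Y) = 0 := by
  cases q with
  | zero => simp [SmoothSimplex.faceIntegral]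
  | succ q =>
    have h : orbitIntegral (boundary q γ) η p g Y = 0 := by
      rw [show boundary q γ = 0 from hγ, orbitIntegral, Finsupp.sum_zero_index]
    rw [orbitIntegral_eq_linearCombination, boundary, Finsupp.linearCombination_apply ℝ γ,
      Finsupp.sum, _root_.map_sum] at h
    rw [Finsupp.sum, ← h]
    refine Finset.sum_congr rfl fun σ _ => ?_
    simp [SmoothSimplex.faceIntegral, _root_.map_sum, Finsupp.linearCombination_single]

/-- The local description of the integrals over the orbits of a smooth simplex as fibre integrals
of forms in a chart of `G`. -/
structure IsOrbitChart (σ : SmoothSimplex E M q) (g : G) (U : Set (Fin q → ℝ))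
    (Ψ : B × (Fin q → ℝ) → M) : Prop where
  isOpen : IsOpen U
  subset : cornerSimplex q ⊆ U
  contMDiffOn : ContMDiffOn 𝓘(ℝ, B × (Fin q → ℝ)) 𝓘(ℝ, E) ∞ Ψ
    ((extChartAt 𝓘(ℝ, B) g).target ×ˢ U)
  localRep_eq : ∀ {n : ℕ} (η : RawForm E M n) (p : ℕ), ∀ b ∈ (extChartAt 𝓘(ℝ, B) g).target,
    ∀ (Y : ℕ → B), ∀ t ∈ cornerSimplex q,
    localRep Ψ η (b, t) (splice n p (fun k => (Y k, 0)) (fibreVec B q)) =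
      σ.orbitIntegrand η p ((extChartAt 𝓘(ℝ, B) g).symm b)
        (fun k => symmDeriv g b (Y k)) t

section

variable {g : G} {σ : SmoothSimplex E M q} {U : Set (Fin q → ℝ)} {Ψ : B × (Fin q → ℝ) → M}

lemma IsOrbitChart.contDiffOn [IsManifold 𝓘(ℝ, E) ∞ M] (hΨ : IsOrbitChart σ g U Ψ) {η : RawForm E M n}
    (hη : IsSmoothForm η) :
    ContDiffOn ℝ ∞ (localRep Ψ η) ((extChartAt 𝓘(ℝ, B) g).target ×ˢ U) :=
  contDiffOn_localRep ((isOpen_extChartAt_target g).prod hΨ.isOpen) hΨ.contMDiffOn hη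

lemma IsOrbitChart.integral_localRep (hΨ : IsOrbitChart σ g U Ψ) (η : RawForm E M n) (p : ℕ) {b : B}
    (hb : b ∈ (extChartAt 𝓘(ℝ, B) g).target) (Y : ℕ → B) :
    ∫ t in cornerSimplex q, localRep Ψ η (b, t) (splice n p (fun k => (Y k, 0)) (fibreVec B q)) =
      σ.orbitIntegral η p ((extChartAt 𝓘(ℝ, B) g).symm b)
        (fun k => symmDeriv g b (Y k)) :=
  setIntegral_congr_fun (measurableSet_cornerSimplex q) fun t ht => hΨ.localRep_eq η p b hb Y t ht

lemma IsOrbitChart.fibreIntegral_apply [IsManifold 𝓘(ℝ, E) ∞ M] (hΨ : IsOrbitChart σ g U Ψ) {η : RawForm E M n}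
    (hη : IsSmoothForm η) {p : ℕ} (h : p ≤ n) {b : B}
    (hb : b ∈ (extChartAt 𝓘(ℝ, B) g).target) (Y : Fin p → B) :
    fibreIntegral h (localRep Ψ η) b Y =
      σ.orbitIntegral η p ((extChartAt 𝓘(ℝ, B) g).symm b) 
        fun k => symmDeriv g b (extendZero Y k) := by
  rw [EquivForms.fibreIntegral_apply h hΨ.subset (hΨ.contDiffOn hη).continuousOn hb,
    hΨ.integral_localRep η p hb]

end

variable [IsManifold 𝓘(ℝ, B) ∞ G] [ContMDiffSMul 𝓘(ℝ, B) 𝓘(ℝ, E) ∞ G M]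

/-- The map `a` with derivative `L` lets one computation serve both a simplex (`a = id`) and its
faces (`a = faceMap j`), seen through the same extension `τ`. -/
lemma localRep_orbitMap_eq (g : G) {V : Type*} [NormedAddCommGroup V] [NormedSpace ℝ V] {τ : V → M}
    {U : Set V} (hU : IsOpen U) (hτ : ContMDiffOn 𝓘(ℝ, V) 𝓘(ℝ, E) ∞ τ U)
    (σ : SmoothSimplex E M q) {a : (Fin q → ℝ) → V} {L : (Fin q → ℝ) →L[ℝ] V}
    (ha : Set.EqOn σ.param (τ ∘ a) (cornerSimplex q)) {t : Fin q → ℝ} (ht : t ∈ cornerSimplex q)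
    (haU : a t ∈ U) (haL : HasFDerivAt a L t) (η : RawForm E M n) (p : ℕ) {b : B}
    (hb : b ∈ (extChartAt 𝓘(ℝ, B) g).target) (Y : ℕ → B) :
    localRep (orbitMap B g τ) η (b, a t)
        (splice n p (fun k => (Y k, 0)) (fun k => (0, L (stdVec q k)))) =
      σ.orbitIntegrand η p ((extChartAt 𝓘(ℝ, B) g).symm b)
        (fun k => symmDeriv g b (Y k)) t := by
  have hx : σ.param t = τ (a t) := ha ht
  have hτa : MDifferentiableAt 𝓘(ℝ, V) 𝓘(ℝ, E) τ (a t) :=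
    (hτ.contMDiffAt (hU.mem_nhds haU)).mdifferentiableAt (by simp)
  have hd : (mfderivWithin 𝓘(ℝ, Fin q → ℝ) 𝓘(ℝ, E) σ.param (cornerSimplex q) t :
      (Fin q → ℝ) →L[ℝ] E) = (mfderiv 𝓘(ℝ, V) 𝓘(ℝ, E) τ (a t) : V →L[ℝ] E).comp L := by
    have ham : MDifferentiableAt 𝓘(ℝ, Fin q → ℝ) 𝓘(ℝ, V) a t :=
      haL.differentiableAt.mdifferentiableAt
    rw [mfderivWithin_cornerSimplex ha ht (hτa.comp t ham), mfderiv_comp t hτa ham,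
      mfderiv_eq_fderiv, haL.fderiv]
    rfl
  unfold SmoothSimplex.orbitIntegrand
  rw [hd]
  refine rawForm_congr η (by rw [hx]; rfl) ?_
  refine (comp_splice (mfderiv 𝓘(ℝ, B × V) 𝓘(ℝ, E) (orbitMap B g τ) (b, a t) : B × V → E)
    n p _ _).trans ?_
  congr 1
  · funext k
    rw [hx]
    exact mfderiv_orbitMap_left g hU hτ hb haU (Y k)
  · funext k
    rw [hx]
    exact mfderiv_orbitMap_right g hU hτ hb haU (L (stdVec q k))

/-- The orbit map of a smooth extension of `σ`. The last clause is Stokes' theorem in the fibre, its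
boundary terms being recognized as orbit integrals over the faces. -/
lemma exists_isOrbitChart [IsManifold 𝓘(ℝ, E) ∞ M] {q : ℕ} (σ : SmoothSimplex E M q) (g : G) :
    ∃ U, ∃ Ψ : B × (Fin q → ℝ) → M, IsOrbitChart σ g U Ψ ∧
      ∀ {n : ℕ} (η : RawForm E M n) (p : ℕ), n + 1 = q + p → IsSmoothForm η →
      ∀ b ∈ (extChartAt 𝓘(ℝ, B) g).target, ∀ (Y : ℕ → B),
      fibreDerivIntegral p (localRep Ψ η) (fun k => (Y k, 0)) b =
        σ.faceIntegral η p ((extChartAt 𝓘(ℝ, B) g).symm b) (fun k => symmDeriv g b (Y k)) := by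
  obtain ⟨U, τ, hU, hsub, hτ, he⟩ := σ.exists_extension
  have hΨ : IsOrbitChart σ g U (orbitMap B g τ) :=
    ⟨hU, hsub, contMDiffOn_orbitMap g hτ, fun η p b hb Y t ht =>
      localRep_orbitMap_eq g hU hτ σ (a := id) (L := ContinuousLinearMap.id ℝ _) he ht
        (hsub ht) (hasFDerivAt_id t) η p hb Y⟩
  refine ⟨U, orbitMap B g τ, hΨ, fun η p hp hη b hb Y => ?_⟩
  cases q with
  | zero => exact fibreDerivIntegral_zero p _ _ b
  | succ q =>
    rw [fibreDerivIntegral_succ (by omega) (isOpen_extChartAt_target g) hU hsub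
      (hΨ.contDiffOn hη) hb]
    refine Finset.sum_congr rfl fun j _ => ?_
    congr 1
    refine setIntegral_congr_fun (measurableSet_cornerSimplex q) fun s hs => ?_
    refine localRep_orbitMap_eq g hU hτ (σ.face j) (fun s hs => ?_) hs
      (hsub (faceMap_mem j hs)) (hasFDerivAt_faceMap j s) η p hb Y
    rw [SmoothSimplex.param_face σ j hs]
    exact he (faceMap_mem j hs)

/-- In an orbit chart the integrand is the restriction of a continuous function to a compact
simplex. This is needed for additivity in the form. -/
lemma integrableOn_orbitIntegrand [IsManifold 𝓘(ℝ, E) ∞ M] (σ : SmoothSimplex E M q) {η : RawForm E M n}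
    (hη : IsSmoothForm η) (p : ℕ) (g : G) (Y : ℕ → B) :
    IntegrableOn (σ.orbitIntegrand η p g Y) (cornerSimplex q) := by
  obtain ⟨U, Ψ, hΨ, -⟩ := exists_isOrbitChart (B := B) σ g
  have hb := mem_extChartAt_target (I := 𝓘(ℝ, B)) g
  let Y' : ℕ → B := fun k => mfderiv 𝓘(ℝ, B) 𝓘(ℝ, B) (extChartAt 𝓘(ℝ, B) g) g (Y k)
  have h1 := integrableOn_slice (μ := volume) (F := fun z => localRep Ψ η z
      (splice n p (fun k => (Y' k, 0)) (fibreVec B q))) (isCompact_cornerSimplex q) hΨ.subset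
    ((ContinuousAlternatingMap.apply ℝ _ ℝ _).continuous.comp_continuousOn
      (hΨ.contDiffOn hη).continuousOn) hb
  refine h1.congr_fun (fun t ht => ?_) (measurableSet_cornerSimplex q)
  refine (hΨ.localRep_eq η p _ hb Y' t ht).trans ?_
  rw [extChartAt_to_inv]
  congr 1
  funext k
  exact symmDeriv_extChartAt_apply g (Y k)

end OrbitIntegral

/-! ### The form on the group defined by a smooth chain -/

section ChainForm

lemma extDeriv_sum_smul {V ι : Type*} [NormedAddCommGroup V] [NormedSpace ℝ V] {p : ℕ}
    (s : Finset ι) (c : ι → ℝ) {F : ι → V → V [⋀^Fin p]→L[ℝ] ℝ} {x : V}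
    (hF : ∀ i, DifferentiableAt ℝ (F i) x) :
    extDeriv (fun y => ∑ i ∈ s, c i • F i y) x = ∑ i ∈ s, c i • extDeriv (F i) x := by
  classical
  induction s using Finset.induction_on with
  | empty =>
    ext v
    simp [extDeriv_apply (differentiableAt_const (0 : V [⋀^Fin p]→L[ℝ] ℝ))]
  | insert i s hi ih =>
    have h1 : DifferentiableAt ℝ (fun y => ∑ i ∈ s, c i • F i y) x :=
      DifferentiableAt.fun_sum fun i _ => (hF i).const_smul (c i)
    simp only [Finset.sum_insert hi]
    have h2 := extDeriv_add ((hF i).const_smul (c i)) h1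
    rw [ih, extDeriv_smul] at h2
    exact h2

variable {B G : Type*} [NormedAddCommGroup B] [NormedSpace ℝ B] [TopologicalSpace G]
  [ChartedSpace B G] [Group G] [IsManifold 𝓘(ℝ, B) ∞ G]
variable {E M : Type*} [NormedAddCommGroup E] [NormedSpace ℝ E] [TopologicalSpace M]
  [ChartedSpace E M] [MulAction G M] [IsManifold 𝓘(ℝ, E) ∞ M]
  [ContMDiffSMul 𝓘(ℝ, B) 𝓘(ℝ, E) ∞ G M] {q n : ℕ}

lemma orbitIntegral_add (γ : SmoothChain E M q) {η ζ : RawForm E M n} (hη : IsSmoothForm η)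
    (hζ : IsSmoothForm ζ) (p : ℕ) (g : G) (Y : ℕ → B) :
    orbitIntegral γ (η + ζ) p g Y = orbitIntegral γ η p g Y + orbitIntegral γ ζ p g Y := by
  simp only [orbitIntegral, Finsupp.sum, ← Finset.sum_add_distrib, ← mul_add]
  refine Finset.sum_congr rfl fun σ _ => ?_
  congr 1
  exact integral_add (integrableOn_orbitIntegrand σ hη p g Y)
    (integrableOn_orbitIntegrand σ hζ p g Y)

omit [IsManifold 𝓘(ℝ, B) ∞ G] [IsManifold 𝓘(ℝ, E) ∞ M]
  [ContMDiffSMul 𝓘(ℝ, B) 𝓘(ℝ, E) ∞ G M] in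
lemma orbitIntegral_smul (γ : SmoothChain E M q) (a : ℝ) (η : RawForm E M n) (p : ℕ) (g : G)
    (Y : ℕ → B) : orbitIntegral γ (a • η) p g Y = a * orbitIntegral γ η p g Y := by
  simp only [orbitIntegral, Finsupp.sum, Finset.mul_sum]
  refine Finset.sum_congr rfl fun σ _ => ?_
  rw [mul_left_comm a]
  congr 1
  exact integral_const_mul a _

omit [IsManifold 𝓘(ℝ, B) ∞ G] [IsManifold 𝓘(ℝ, E) ∞ M]
  [ContMDiffSMul 𝓘(ℝ, B) 𝓘(ℝ, E) ∞ G M] in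
lemma orbitIntegral_zero (γ : SmoothChain E M q) (p : ℕ) (g : G) (Y : ℕ → B) :
    orbitIntegral γ (0 : RawForm E M n) p g Y = 0 := by
  simpa using orbitIntegral_smul γ 0 (0 : RawForm E M n) p g Y

omit [IsManifold 𝓘(ℝ, B) ∞ G] [ContMDiffSMul 𝓘(ℝ, B) 𝓘(ℝ, E) ∞ G M] in
lemma sum_fibreIntegral_apply (γ : SmoothChain E M q) {η : RawForm E M n} (hη : IsSmoothForm η)
    {p : ℕ} (h : p ≤ n) {g : G} {U : SmoothSimplex E M q → Set (Fin q → ℝ)}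
    {Ψ : SmoothSimplex E M q → B × (Fin q → ℝ) → M} (hΨ : ∀ σ, IsOrbitChart σ g (U σ) (Ψ σ)) {b : B}
    (hb : b ∈ (extChartAt 𝓘(ℝ, B) g).target) (Y : Fin p → B) :
    (∑ σ ∈ γ.support, γ σ • fibreIntegral h (localRep (Ψ σ) η) b) Y =
      orbitIntegral γ η p ((extChartAt 𝓘(ℝ, B) g).symm b)
        (extendZero fun i => symmDeriv g b (Y i)) := by
  rw [ContinuousAlternatingMap.sum_apply, extendZero_comp _ (_root_.map_zero _)]
  refine Finset.sum_congr rfl fun σ _ => ?_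
  rw [ContinuousAlternatingMap.smul_apply, (hΨ σ).fibreIntegral_apply hη h hb]
  rfl

/-- A form on `G` is the one defined by the chain `γ` and the form `η` on `M` if its values are the
integrals of `η` over the translates of `γ`, after inserting vectors tangent to the orbits. -/
def IsChainForm (γ : SmoothChain E M q) (η : RawForm E M n) {p : ℕ} (α : RawForm B G p) : Prop :=
  ∀ (g : G) (Y : Fin p → B), α g Y = orbitIntegral γ η p g (extendZero Y)

omit [IsManifold 𝓘(ℝ, B) ∞ G] [ContMDiffSMul 𝓘(ℝ, B) 𝓘(ℝ, E) ∞ G M] in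
-- The two forms agree on every tuple of vectors. Smoothness and the exterior derivative of `α` are
-- both read off from this expression.
lemma IsChainForm.chartRep_eq {γ : SmoothChain E M q} {η : RawForm E M n} (hη : IsSmoothForm η)
    {p : ℕ} {α : RawForm B G p} (hα : IsChainForm γ η α)
    (h : p ≤ n) {g : G} {U : SmoothSimplex E M q → Set (Fin q → ℝ)}
    {Ψ : SmoothSimplex E M q → B × (Fin q → ℝ) → M} (hΨ : ∀ σ, IsOrbitChart σ g (U σ) (Ψ σ)) {b : B}
    (hb : b ∈ (extChartAt 𝓘(ℝ, B) g).target) :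
    chartRep α g b = ∑ σ ∈ γ.support, γ σ • fibreIntegral h (localRep (Ψ σ) η) b := by
  ext Y
  rw [sum_fibreIntegral_apply γ hη h hΨ hb]
  exact hα _ _

omit [IsManifold 𝓘(ℝ, B) ∞ G] [ContMDiffSMul 𝓘(ℝ, B) 𝓘(ℝ, E) ∞ G M] in
lemma IsOrbitChart.contDiffOn_fibreIntegral {σ : SmoothSimplex E M q} {η : RawForm E M n}
    (hη : IsSmoothForm η) {p : ℕ} (h : p ≤ n) {g : G} {U : Set (Fin q → ℝ)}
    {Ψ : B × (Fin q → ℝ) → M} (hΨ : IsOrbitChart σ g U Ψ) :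
    ContDiffOn ℝ ∞ (fibreIntegral h (localRep Ψ η)) (extChartAt 𝓘(ℝ, B) g).target :=
  EquivForms.contDiffOn_fibreIntegral h (isOpen_extChartAt_target g) hΨ.isOpen hΨ.subset
    (hΨ.contDiffOn hη)

lemma IsChainForm.isSmoothForm {γ : SmoothChain E M q} {η : RawForm E M n} (hη : IsSmoothForm η)
    {p : ℕ} (h : p ≤ n) {α : RawForm B G p} (hα : IsChainForm γ η α) : IsSmoothForm α := by
  intro g
  choose U Ψ hΨ _ using fun σ : SmoothSimplex E M q => exists_isOrbitChart (B := B) σ g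
  refine ContDiffOn.congr ?_ fun b hb => hα.chartRep_eq hη h hΨ hb
  exact ContDiffOn.sum fun σ _ =>
    (contDiffOn_const (c := γ σ)).smul (IsOrbitChart.contDiffOn_fibreIntegral hη h (hΨ σ))

/-- At each `g` the orbit integral is the value of a fibre integral in the chart at `g`, hence
alternating and continuous in `Y`. The charts need no gluing, as the orbit integral does not depend
on them. -/
lemma exists_isChainForm (γ : SmoothChain E M q) {η : RawForm E M n} (hη : IsSmoothForm η)
    {p : ℕ} (h : p ≤ n) : ∃ α : Form B G p, IsChainForm γ η α.1 := by
  have key : ∀ g : G, ∃ A : B [⋀^Fin p]→L[ℝ] ℝ,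
      ∀ Y, A Y = orbitIntegral γ η p g (extendZero Y) := fun g => by
    choose U Ψ hΨ _ using fun σ : SmoothSimplex E M q => exists_isOrbitChart (B := B) σ g
    have hb := mem_extChartAt_target (I := 𝓘(ℝ, B)) g
    refine ⟨(∑ σ ∈ γ.support, γ σ • fibreIntegral h (localRep (Ψ σ) η)
      (extChartAt 𝓘(ℝ, B) g g)).compContinuousLinearMap
        (mfderiv 𝓘(ℝ, B) 𝓘(ℝ, B) (extChartAt 𝓘(ℝ, B) g) g), fun Y => ?_⟩
    refine (sum_fibreIntegral_apply γ hη h hΨ hb _).trans ?_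
    rw [extChartAt_to_inv]
    congr 2
    funext i
    exact symmDeriv_extChartAt_apply g (Y i)
  choose α hα using key
  have hα' : IsChainForm γ η (α : RawForm B G p) := hα
  exact ⟨⟨α, hα'.isSmoothForm hη h⟩, hα'⟩

/-- The exterior derivative of the form defined by a cycle. -/
lemma IsChainForm.extDerivRaw {γ : SmoothChain E M q} (hγ : IsCycle γ) {p : ℕ}
    {η : RawForm E M (q + p)} (hη : IsSmoothForm η) {α : RawForm B G p}
    (hα : IsChainForm γ η α) : IsChainForm γ (extDerivRaw η) (extDerivRaw α) := by
  intro g Y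
  choose U Ψ hΨ hbd using fun σ : SmoothSimplex E M q => exists_isOrbitChart (B := B) σ g
  have hT := isOpen_extChartAt_target (I := 𝓘(ℝ, B)) g
  have hb := mem_extChartAt_target (I := 𝓘(ℝ, B)) g
  have h : p ≤ q + p := Nat.le_add_left p q
  have hrep : chartRep α g =ᶠ[𝓝 (extChartAt 𝓘(ℝ, B) g g)]
      fun b => ∑ σ ∈ γ.support, γ σ • fibreIntegral h (localRep (Ψ σ) η) b := by
    filter_upwards [hT.mem_nhds hb] with b hb
    exact hα.chartRep_eq hη h hΨ hb
  let Y' : Fin (p + 1) → B := fun i => mfderiv 𝓘(ℝ, B) 𝓘(ℝ, B) (extChartAt 𝓘(ℝ, B) g) g (Y i)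
  have hY : (fun k => symmDeriv g (extChartAt 𝓘(ℝ, B) g g) (extendZero Y' k)) = extendZero Y := by
    rw [← extendZero_comp _ (_root_.map_zero _)]
    congr 1
    funext i
    exact symmDeriv_extChartAt_apply g (Y i)
  -- For a single simplex the boundary term remains; it disappears only after summation over the
  -- cycle, in `hz`.
  have hσ : ∀ σ : SmoothSimplex E M q, σ.orbitIntegral (EquivForms.extDerivRaw η) (p + 1) g
      (extendZero Y) = extDeriv (fibreIntegral h (localRep (Ψ σ) η)) (extChartAt 𝓘(ℝ, B) g g) Y' +
        (-1 : ℝ) ^ (p + 1) * σ.faceIntegral η (p + 1) g (extendZero Y) := fun σ => by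
    have h1 := (hΨ σ).integral_localRep (EquivForms.extDerivRaw η) (p + 1) hb (extendZero Y')
    have h2 := integral_extDeriv_succ (add_comm q p) hT (hΨ σ).isOpen (hΨ σ).subset
      ((hΨ σ).contDiffOn hη) hb Y'
    rw [hbd σ η (p + 1) rfl hη _ hb] at h2
    rw [hY, extChartAt_to_inv] at h1 h2
    rw [← h1, ← h2]
    refine setIntegral_congr_fun (measurableSet_cornerSimplex q) fun t ht => ?_
    rw [extDeriv_localRep (hT.prod (hΨ σ).isOpen) (hΨ σ).contMDiffOn hη ⟨hb, (hΨ σ).subset ht⟩]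
  have hd : ∀ σ, DifferentiableAt ℝ (fibreIntegral h (localRep (Ψ σ) η))
      (extChartAt 𝓘(ℝ, B) g g) := fun σ =>
    ((IsOrbitChart.contDiffOn_fibreIntegral hη h (hΨ σ)).contDiffAt
      (hT.mem_nhds hb)).differentiableAt (by simp)
  have hz := sum_faceIntegral_eq_zero hγ η (p + 1) g (extendZero Y)
  change extDeriv (chartRep α g) (extChartAt 𝓘(ℝ, B) g g) Y' = _
  rw [hrep.extDeriv_eq, extDeriv_sum_smul _ _ hd, ContinuousAlternatingMap.sum_apply]
  have hs : orbitIntegral γ (EquivForms.extDerivRaw η) (p + 1) g (extendZero Y) =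
      ∑ σ ∈ γ.support, γ σ * extDeriv (fibreIntegral h (localRep (Ψ σ) η))
        (extChartAt 𝓘(ℝ, B) g g) Y' + (-1 : ℝ) ^ (p + 1) *
          γ.sum fun σ a => a * σ.faceIntegral η (p + 1) g (extendZero Y) := by
    simp only [orbitIntegral, Finsupp.sum, Finset.mul_sum, ← Finset.sum_add_distrib]
    refine Finset.sum_congr rfl fun σ _ => ?_
    rw [hσ σ]
    ring
  rw [hz, mul_zero, add_zero] at hs
  exact hs.symm

/-- The integral of an exact form over a cycle vanishes. -/
lemma orbitIntegral_extDerivRaw_eq_zero {γ : SmoothChain E M (n + 1)} (hγ : IsCycle γ)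
    {η : RawForm E M n} (hη : IsSmoothForm η) (g : G) (Y : ℕ → B) :
    orbitIntegral γ (extDerivRaw η) 0 g Y = 0 := by
  have hT := isOpen_extChartAt_target (I := 𝓘(ℝ, B)) g
  have hb := mem_extChartAt_target (I := 𝓘(ℝ, B)) g
  rw [← sum_faceIntegral_eq_zero hγ η 0 g Y]
  refine Finset.sum_congr rfl fun σ _ => ?_
  obtain ⟨U, Ψ, hΨ, hbd⟩ := exists_isOrbitChart (B := B) σ g
  let Y' : ℕ → B := fun k => mfderiv 𝓘(ℝ, B) 𝓘(ℝ, B) (extChartAt 𝓘(ℝ, B) g) g (Y k)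
  have hY : (fun k => symmDeriv g (extChartAt 𝓘(ℝ, B) g g) (Y' k)) = Y :=
    funext fun k => symmDeriv_extChartAt_apply g (Y k)
  have h1 := hΨ.integral_localRep (extDerivRaw η) 0 hb Y'
  -- With no base vectors the base derivatives form an empty sum and only the boundary term is left.
  have h2 := integral_extDeriv_splice (p := 0) (zero_add (n + 1)).symm hT hΨ.isOpen hΨ.subset
    (hΨ.contDiffOn hη) hb fun k => (Y' k, 0)
  rw [hbd η 0 rfl hη _ hb, Finset.range_zero, Finset.sum_empty, zero_add, pow_zero, one_mul] at h2
  rw [hY, extChartAt_to_inv] at h1 h2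
  dsimp only
  rw [← h1, ← h2]
  congr 1
  refine setIntegral_congr_fun (measurableSet_cornerSimplex _) fun t ht => ?_
  rw [extDeriv_localRep (hT.prod hΨ.isOpen) hΨ.contMDiffOn hη ⟨hb, hΨ.subset ht⟩]

end ChainForm

/-! ### The map `f_γ` -/

section FGammaLemmas

/-- `i(X_1)` acts first and fills the first slot, so `X_1, …, X_p` precede `v` in their natural
order and no sign arises. -/
lemma contract_apply {V : Type*} [NormedAddCommGroup V] [NormedSpace ℝ V] {q : ℕ} (p : ℕ)
    (X : Fin p → V) (θ : V [⋀^Fin (q + p)]→L[ℝ] ℝ) (v : Fin q → V) (e : ℕ → V)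
    (he : ∀ i : Fin q, v i = e i) :
    contract p X θ v = θ (splice (q + p) p (extendZero X) e) := by
  induction p with
  | zero =>
    change θ v = _
    congr 1
    funext i
    simpa [splice] using he i
  | succ p ih =>
    refine (ih (Fin.tail X) (ContinuousAlternatingMap.curryLeft θ (X 0))).trans ?_
    rw [ContinuousAlternatingMap.curryLeft_apply_apply]
    congr 1
    funext i
    refine Fin.cases ?_ (fun j => ?_) i
    · simp [splice, extendZero, Matrix.vecCons]
    · by_cases hj : (j : ℕ) < p
      · simp [splice, extendZero, Matrix.vecCons, hj, Fin.tail]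
      · simp [splice, Matrix.vecCons, hj]

variable {B G : Type*} [NormedAddCommGroup B] [NormedSpace ℝ B] [TopologicalSpace G]
  [ChartedSpace B G] [Group G] [LieGroup 𝓘(ℝ, B) ∞ G]
variable {E M : Type*} [NormedAddCommGroup E] [NormedSpace ℝ E] [TopologicalSpace M]
  [ChartedSpace E M] [MulAction G M]
  [ContMDiffSMul 𝓘(ℝ, B) 𝓘(ℝ, E) ∞ G M] {q n : ℕ}

/-- Right multiplication by `g` is the orbit map of `g` for the action of `G` on itself by left
translations. -/
lemma mdifferentiableAt_mul_right_const (g h : G) :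
    MDifferentiableAt 𝓘(ℝ, B) 𝓘(ℝ, B) (fun k : G => k * g) h :=
  (contMDiff_smul_left (B := B) (E := B) (G := G) g).mdifferentiableAt (by simp)

lemma mdifferentiableAt_mul_left_const (g h : G) :
    MDifferentiableAt 𝓘(ℝ, B) 𝓘(ℝ, B) (fun k : G => g * k) h :=
  (contMDiff_action (E := B) B g).mdifferentiableAt (by simp)

/-- The fundamental field along an orbit is the image of the right invariant field. -/
lemma fundamentalField_smul (X : B) (g : G) (x : M) :
    (fundamentalField (G := G) E M (X : TangentSpace 𝓘(ℝ, B) (1 : G)) (g • x) : E) =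
      (mfderiv 𝓘(ℝ, B) 𝓘(ℝ, E) (fun h : G => h • x) g
        (rightInvariantField (X : TangentSpace 𝓘(ℝ, B) (1 : G)) g : B) : E) := by
  have h1 : MDifferentiableAt 𝓘(ℝ, B) 𝓘(ℝ, E) (fun h : G => h • x) ((1 : G) * g) :=
    (contMDiff_smul_left (B := B) (E := E) (G := G) x).mdifferentiableAt (by simp)
  have h2 := mfderiv_comp (1 : G) h1 (mdifferentiableAt_mul_right_const (B := B) g 1)
  have h3 : ((fun h : G => h • x) ∘ fun h : G => h * g) = fun h : G => h • (g • x) := by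
    funext h
    exact mul_smul h g x
  rw [h3] at h2
  -- The chain rule yields the derivative at `1 * g`; a variable `k` makes it possible to replace
  -- this point by `g` despite the dependent type.
  have h4 : ∀ k : G, k = g → (mfderiv 𝓘(ℝ, B) 𝓘(ℝ, E) (fun h : G => h • x) k : B →L[ℝ] E) =
      mfderiv 𝓘(ℝ, B) 𝓘(ℝ, E) (fun h : G => h • x) g := by
    rintro _ rfl
    rfl
  exact (DFunLike.congr_fun h2 X).trans (DFunLike.congr_fun (h4 (1 * g) (one_mul g)) _)

/-- Right translation by `g⁻¹` carries `Y` back to the identity. Thus testing a form on right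
invariant fields determines it. -/
lemma exists_rightInvariantField_eq (g : G) (Y : B) :
    ∃ X : B, (rightInvariantField (X : TangentSpace 𝓘(ℝ, B) (1 : G)) g : B) = Y := by
  refine ⟨(mfderiv 𝓘(ℝ, B) 𝓘(ℝ, B) (fun h : G => h * g⁻¹) g Y : B), ?_⟩
  have h1 := mdifferentiableAt_mul_right_const (B := B) g (g * g⁻¹)
  have h2 := mfderiv_comp g h1 (mdifferentiableAt_mul_right_const (B := B) g⁻¹ g)
  have h3 : ((fun h : G => h * g) ∘ fun h : G => h * g⁻¹) = id := by
    funext h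
    simp
  rw [h3, mfderiv_id] at h2
  have h4 : ∀ k : G, k = 1 → (mfderiv 𝓘(ℝ, B) 𝓘(ℝ, B) (fun h : G => h * g) k : B →L[ℝ] B) =
      mfderiv 𝓘(ℝ, B) 𝓘(ℝ, B) (fun h : G => h * g) 1 := by
    rintro _ rfl
    rfl
  exact (DFunLike.congr_fun (h4 (g * g⁻¹) (mul_inv_cancel g)) _).symm.trans
    (DFunLike.congr_fun h2 Y).symm

/-- By `fundamentalField_smul`, inserting fundamental fields at `g • x` is inserting the images of
the right invariant fields at `g` under the orbit map. -/
lemma chainIntegral_pullback_contractFundamental (γ : SmoothChain E M q) {p : ℕ}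
    (X : Fin p → B) (θ : RawForm E M (q + p)) (g : G) :
    chainIntegral γ (pullback (E := E) (fun x : M => g • x)
      (contractFundamental (G := G) (fun i => (X i : TangentSpace 𝓘(ℝ, B) (1 : G))) θ)) =
      orbitIntegral γ θ p g (extendZero (W := B) fun i =>
        (rightInvariantField (X i : TangentSpace 𝓘(ℝ, B) (1 : G)) g : B)) := by
  refine Finset.sum_congr rfl fun σ _ => ?_
  dsimp only
  congr 1
  refine setIntegral_congr_fun (measurableSet_cornerSimplex q) fun t _ => ?_
  refine (contract_apply (V := E) p _ _ _ (fun k => (mfderiv 𝓘(ℝ, E) 𝓘(ℝ, E) (fun x : M => g • x)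
    (σ.param t) (mfderivWithin 𝓘(ℝ, Fin q → ℝ) 𝓘(ℝ, E) σ.param (cornerSimplex q) t
      (stdVec q k)) : E)) fun i => ?_).trans ?_
  · rw [stdVec_val]
    rfl
  · unfold SmoothSimplex.orbitIntegrand
    congr 2
    refine Eq.trans ?_ (extendZero_comp
      (fun Y : B => (mfderiv 𝓘(ℝ, B) 𝓘(ℝ, E) (fun h : G => h • σ.param t) g Y : E))
      (_root_.map_zero _) _)
    congr 1
    funext i
    exact fundamentalField_smul (X i) g (σ.param t)

lemma isFGamma_iff {γ : SmoothChain E M q} {f : DeRham E M →ₗ[ℝ] DeRham B G} :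
    IsFGamma γ f ↔ ∀ θ p, IsChainForm γ (θ (q + p)).1 (f θ p).1 := by
  refine forall_congr' fun θ => forall_congr' fun p => ⟨fun h g Y => ?_, fun h X g => ?_⟩
  · choose X hX using fun i => exists_rightInvariantField_eq g (Y i)
    have h2 : (fun i => (rightInvariantField (X i : TangentSpace 𝓘(ℝ, B) (1 : G)) g : B)) = Y :=
      funext hX
    have h1 := chainIntegral_pullback_contractFundamental γ X (θ (q + p)).1 g
    rw [h2] at h1
    exact (rawForm_congr (f θ p).1 rfl h2.symm).trans ((h X g).trans h1)
  · exact (h g _).trans (chainIntegral_pullback_contractFundamental (B := B) γ X _ g).symm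

omit [LieGroup 𝓘(ℝ, B) ∞ G] [ContMDiffSMul 𝓘(ℝ, B) 𝓘(ℝ, E) ∞ G M] in
lemma IsChainForm.eq {γ : SmoothChain E M q} {η : RawForm E M n} {p : ℕ} {α β : RawForm B G p}
    (hα : IsChainForm γ η α) (hβ : IsChainForm γ η β) : α = β := by
  funext g
  exact ContinuousAlternatingMap.ext fun Y => (hα g Y).trans (hβ g Y).symm

/-- The form on `G` defined by a chain is equivariant. -/
lemma IsChainForm.pullback {γ : SmoothChain E M q} {η : RawForm E M n} {p : ℕ} {α : RawForm B G p}
    (hα : IsChainForm γ η α) (g : G) :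
    IsChainForm γ (pullback (E := E) (fun x : M => g • x) η)
      (pullback (E := B) (fun x : G => g • x) α) := by
  intro h Y
  refine (hα (g • h) _).trans ?_
  refine Finset.sum_congr rfl fun σ _ => ?_
  dsimp only
  congr 1
  refine setIntegral_congr_fun (measurableSet_cornerSimplex q) fun t _ => ?_
  refine rawForm_congr η (mul_smul g h (σ.param t)) ?_
  have hg : ∀ x : M, MDifferentiableAt 𝓘(ℝ, E) 𝓘(ℝ, E) (fun x : M => g • x) x := fun x =>
    (contMDiff_action B g).mdifferentiableAt (by simp)
  have hh : MDifferentiableAt 𝓘(ℝ, E) 𝓘(ℝ, E) (fun x : M => h • x) (σ.param t) :=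
    (contMDiff_action B h).mdifferentiableAt (by simp)
  have ho : ∀ k : G, MDifferentiableAt 𝓘(ℝ, B) 𝓘(ℝ, E) (fun k : G => k • σ.param t) k := fun k =>
    (contMDiff_smul_left (B := B) (E := E) (G := G) (σ.param t)).mdifferentiableAt (by simp)
  -- The two blocks of vectors are compared separately: `e1` serves those tangent to the orbits,
  -- `e2` those tangent to the simplex.
  have e1 : ((fun k : G => k • σ.param t) ∘ fun k : G => g • k) =
      (fun x : M => g • x) ∘ fun k : G => k • σ.param t := by
    funext k
    exact mul_smul g k (σ.param t)
  have e2 : (fun x : M => (g • h) • x) = (fun x : M => g • x) ∘ fun x : M => h • x := by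
    funext x
    exact mul_smul g h x
  have d1 := mfderiv_comp h (ho (g • h)) (mdifferentiableAt_mul_left_const (B := B) g h)
  have d2 := mfderiv_comp h (hg (h • σ.param t)) (ho h)
  have d3 := mfderiv_comp (σ.param t) (hg (h • σ.param t)) hh
  refine Eq.trans ?_ (comp_splice (mfderiv 𝓘(ℝ, E) 𝓘(ℝ, E) (fun x : M => g • x)
    (h • σ.param t) : E → E) n p _ _).symm
  congr 1
  · refine (congrArg (fun Z : ℕ → B => fun k => (mfderiv 𝓘(ℝ, B) 𝓘(ℝ, E)
      (fun k : G => k • σ.param t) (g • h) (Z k) : E)) (extendZero_comp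
      (fun Y : B => (mfderiv 𝓘(ℝ, B) 𝓘(ℝ, B) (fun k : G => g • k) h Y : B))
      (_root_.map_zero _) Y)).trans ?_
    funext k
    have d4 : (mfderiv 𝓘(ℝ, B) 𝓘(ℝ, E) ((fun k : G => k • σ.param t) ∘ fun k : G => g • k) h :
        B →L[ℝ] E) = mfderiv 𝓘(ℝ, B) 𝓘(ℝ, E)
          ((fun x : M => g • x) ∘ fun k : G => k • σ.param t) h := by rw [e1]
    exact (DFunLike.congr_fun d1 (extendZero Y k)).symm.trans
      ((DFunLike.congr_fun d4 (extendZero Y k)).trans (DFunLike.congr_fun d2 (extendZero Y k)))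
  · funext k
    rw [e2]
    exact DFunLike.congr_fun d3 _

end FGammaLemmas

end EquivForms

/-! ### Existence, uniqueness and the homomorphism of double complexes -/

theorem mainTheorem8
    {B : Type*} [NormedAddCommGroup B] [NormedSpace ℝ B] [FiniteDimensional ℝ B]
    {G : Type*} [TopologicalSpace G] [ChartedSpace B G] [Group G] [LieGroup 𝓘(ℝ, B) ∞ G]
    {E : Type*} [NormedAddCommGroup E] [NormedSpace ℝ E] [FiniteDimensional ℝ E]
    {M : Type*} [TopologicalSpace M] [ChartedSpace E M] [IsManifold 𝓘(ℝ, E) ∞ M]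
    [MulAction G M] [ContMDiffSMul 𝓘(ℝ, B) 𝓘(ℝ, E) ∞ G M]
    {q : ℕ} (γ : SmoothChain E M q) (hγ : IsCycle γ) :
    (∃! f : DeRham E M →ₗ[ℝ] DeRham B G, IsFGamma γ f) ∧
    ∀ f : DeRham E M →ₗ[ℝ] DeRham B G, IsFGamma γ f →
      (∀ (g : G) (θ : DeRham E M), f (act B g θ) = act B g (f θ)) ∧
      (∀ θ : DeRham E M, dR (f θ) = f (dR θ)) ∧
      IsDoubleComplexHom B q (compCochain f) := by
  refine ⟨?_, fun f hf => ?_⟩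
  · have hex := fun (θ : DeRham E M) (p : ℕ) =>
      exists_isChainForm (B := B) (G := G) γ (θ (q + p)).2 (Nat.le_add_left p q)
    choose F hF using hex
    refine ⟨⟨⟨F, fun θ η => ?_⟩, fun a θ => ?_⟩, isFGamma_iff.2 hF, fun f' hf' => ?_⟩
    · funext p
      refine Subtype.ext ((hF (θ + η) p).eq fun g Y => ?_)
      refine Eq.trans ?_ (orbitIntegral_add γ (θ (q + p)).2 (η (q + p)).2 p g _).symm
      exact congrArg₂ (· + ·) (hF θ p g Y) (hF η p g Y)
    · funext p
      refine Subtype.ext ((hF (a • θ) p).eq fun g Y => ?_)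
      refine Eq.trans ?_ (orbitIntegral_smul γ a (θ (q + p)).1 p g _).symm
      exact congrArg (a * ·) (hF θ p g Y)
    · refine LinearMap.ext fun θ => funext fun p => Subtype.ext ?_
      exact (isFGamma_iff.1 hf' θ p).eq (hF θ p)
  · have hf' := isFGamma_iff.1 hf
    have hact : ∀ (g : G) (θ : DeRham E M), f (act B g θ) = act B g (f θ) := fun g θ => by
      funext p
      exact Subtype.ext ((hf' (act B g θ) p).eq ((hf' θ p).pullback g))
    have hd : ∀ θ : DeRham E M, dR (f θ) = f (dR θ) := fun θ => by
      funext p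
      refine Subtype.ext ?_
      cases p with
      | zero =>
        -- The degree `0` component of `dR (f θ)` is zero by definition. That of `f (dR θ)` vanishes
        -- because `dR θ` has no degree `0` component if `q = 0`, and otherwise because exact forms
        -- integrate to zero over a cycle.
        refine IsChainForm.eq (fun g Y => ?_) (hf' (dR θ) 0)
        cases q with
        | zero => exact (orbitIntegral_zero γ 0 g _).symm
        | succ q => exact (orbitIntegral_extDerivRaw_eq_zero hγ (θ q).2 g _).symm
      | succ p =>
        exact IsChainForm.eq ((hf' θ p).extDerivRaw hγ (θ (q + p)).2) (hf' (dR θ) (p + 1))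
    -- Both degree statements follow from this: a cochain concentrated in degree `q + p` lands in
    -- degree `p`, and one in degree `k < q` meets no index `q + p`.
    have hzero : ∀ (θ : DeRham E M) (p : ℕ), θ (q + p) = 0 → f θ p = 0 := fun θ p h => by
      refine Subtype.ext ((hf' θ p).eq fun g Y => ?_)
      rw [h]
      exact (orbitIntegral_zero γ p g _).symm
    refine ⟨hact, hd, ⟨fun s c => ?_, fun s c => ?_, fun s p c hc => ?_, fun s k hk c hc => ?_⟩⟩
    · funext g
      simp only [delta', compCochain, LinearMap.coe_mk, AddHom.coe_mk, map_add, map_sum, map_smul,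
        hact]
    · funext g
      simp only [delta'', compCochain, LinearMap.coe_mk, AddHom.coe_mk, map_smul, hd]
    · intro g j hj
      exact hzero _ j (hc g (q + j) (by omega))
    · funext g p
      exact hzero _ p (hc g (q + p) (by omega))
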